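/- **Conventions.** $\mathcal A$ is an abelian category whose derived category $D(\mathcal A)$ has Hom-sets; $D^b(\mathcal A)\subseteq D(\mathcal A)$ is the full subcategory of objects with bounded cohomology. $\mathcal A$ has *finite global dimension* if $\operatorname{Ext}^n_{\mathcal A}(-,-)=0$ (Yoneda) for some integer $n>0$. $\mathcal A$ has a *projective generator* (resp. *injective cogenerator*) if it has a projective $P$ with $\operatorname{Hom}(P,-)$ faithful (resp. an injective $E$ with $\operatorname{Hom}(-,E)$ faithful). $D(\mathcal A)$ is *TR5* (resp. *TR5\**) if it has all set-indexed coproducts (resp. products). The heart of a t-structure $\mathbb T=(\mathbb T^{\le 0},\mathbb T^{\ge 0})$ is $\mathcal H(\mathbb T)=\mathbb T^{\le 0}\cap\mathbb T^{\ge 0}$, an abelian category, and $\mathbb T^{\le n}=\mathbb T^{\le 0}[-n]$, $\mathbb T^{\ge n}=\mathbb T^{\ge 0}[-n]$. For $M$ in $D(\mathcal A)$ and $I\subseteq\mathbb Z$ put $M^{\perp_I}=\{Y:\operatorname{Hom}(M,Y[i])=0\ \forall i\in I\}$ and ${}^{\perp_I}M=\{Y:\operatorname{Hom}(Y,M[i])=0\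 \forall i\in I\}$. $\operatorname{Add}(M)$ (resp. $\operatorname{Prod}(M)$) is the class of direct summands of set-indexed coproducts (resp. products) of copies of $M$. $M$ is *tilting* if $(M^{\perp_{>0}},M^{\perp_{<0}})$ is a t-structure, $M\in M^{\perp_{>0}}$ and $\operatorname{Add}(M)\subseteq M^{\perp_{\ne 0}}$; $M$ is *cotilting* if $({}^{\perp_{<0}}M,{}^{\perp_{>0}}M)$ is a t-structure, $M\in{}^{\perp_{>0}}M$ and $\operatorname{Prod}(M)\subseteq{}^{\perp_{\ne 0}}M$. *f-categories.* An f-category is a triangulated category $\mathcal X$ with a triangle autoequivalence $s$, a natural transformation $\alpha\colon\mathrm{id}\to s$ and strictly full triangulated subcategories $\mathcal X(\ge 0)$, $\mathcal X(\le 0)$ such that, with $\mathcal X(\ge n)=s^n\mathcal X(\ge 0)$ and $\mathcal X(\le n)=s^n\mathcal X(\le 0)$: $\operatorname{Hom}(\mathcal X(\ge1),\mathcal X(\le0))=0$; every $X$ fits in a triangle $Y\to X\to Z\to Y[1]$ with $Y\in\mathcal X(\ge 1)$, $Z\in\mathcal X(\le 0)$; every object lies in some $\mathcal X(\ge n)$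 and in some $\mathcal X(\le n)$; $\mathcal X(\ge1)\subseteq\mathcal X(\ge0)$ and $\mathcal X(\le-1)\subseteq\mathcal X(\le0)$; $\alpha_{sX}=s(\alpha_X)$; and for $X\in\mathcal X(\ge1)$, $Y\in\mathcal X(\le0)$ the maps $\operatorname{Hom}(sY,X)\to\operatorname{Hom}(Y,X)\to\operatorname{Hom}(Y,sX)$ induced by $\alpha_Y$ and $\alpha_X$ are bijective. It is an f-category *over* a triangulated category $\mathcal T$ if it comes with a triangle equivalence $\theta\colon\mathcal T\to\mathcal X(\ge0)\cap\mathcal X(\le0)$. (For instance, the filtered derived category of $\mathcal A$ is an f-category over $D(\mathcal A)$.) An *f-forgetful functor* is a triangle functor $\omega\colon\mathcal X\to\mathcal T$ whose restriction to $\mathcal X(\ge0)$ (resp. $\mathcal X(\le0)$) is right (resp. left) adjoint to the functor induced by $\theta$, which inverts every $\alpha_X$ and which induces bijections $\operatorname{Hom}(X,Y)\to\operatorname{Hom}(\omega X,\omega Y)$ for $X\in\mathcal X(\le0)$, $Y\in\mathcal X(\ge0)$. Let $\sigma_{\ge n},\sigma_{\le n}$ be the truncations onto $\mathcal X(\ge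 n)$, $\mathcal X(\le n)$ and $\operatorname{gr}^n=\omega\sigma_{\le n}\sigma_{\ge n}\ (\cong\theta^{-1}s^{-n}\sigma_{\le n}\sigma_{\ge n})$. *Realisation functors.* Given a t-structure $\mathbb T$ in $\mathcal T$ and an f-category over $\mathcal T$ with f-forgetful functor $\omega$, let $\mathcal H(\mathbb X)\subseteq\mathcal X$ be the full subcategory of the $X$ with $\operatorname{gr}^nX\in\mathbb T^{\le n}\cap\mathbb T^{\ge n}$ for all $n$. There is an equivalence $H^0_{\mathbb X}\colon\mathcal H(\mathbb X)\to C^b(\mathcal H(\mathbb T))$ sending $X$ to the complex with components $(\operatorname{gr}^iX)[i]$ and differentials induced by the connecting morphisms $\operatorname{gr}^iX\to(\operatorname{gr}^{i+1}X)[1]$ of the triangles $\sigma_{\le i+1}\sigma_{\ge i+1}X\to\sigma_{\le i+1}\sigma_{\ge i}X\to\sigma_{\le i}\sigma_{\ge i}X\to$. Let $G$ be a quasi-inverse. A *realisation functor* is a functor $\mathrm{real}_{\mathbb T}\colon D^b(\mathcal H(\mathbb T))\to\mathcal T$ with $\mathrm{real}_{\mathbb T}\circ Q\cong\omega\circ G$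 as functors $C^b(\mathcal H(\mathbb T))\to\mathcal T$, where $Q\colon C^b(\mathcal H(\mathbb T))\to D^b(\mathcal H(\mathbb T))$ is the localisation. **Proposition.** Let $\mathbb T$ be a t-structure in $D(\mathcal A)$ whose bounded objects are exactly those of $D^b(\mathcal A)$, i.e. $\bigcup_{a\le b}\mathbb T^{\ge a}\cap\mathbb T^{\le b}=D^b(\mathcal A)$. Assume that $\mathcal A$ has a projective generator and $D(\mathcal A)$ is TR5 (respectively, $\mathcal A$ has an injective cogenerator and $D(\mathcal A)$ is TR5\*). 1. Suppose that, for some f-category over $D(\mathcal A)$ with an f-forgetful functor, a realisation functor $\mathrm{real}_{\mathbb T}\colon D^b(\mathcal H(\mathbb T))\to D(\mathcal A)$ is fully faithful. If $\mathcal A$ has finite global dimension, then so does $\mathcal H(\mathbb T)$. 2. If $\mathbb T=(M^{\perp_{>0}},M^{\perp_{<0}})$ for a tilting object $M$ of $D(\mathcal A)$ (respectively, $\mathbb T=({}^{\perp_{<0}}M,{}^{\perp_{>0}}M)$ for a cotilting object $M$ of $D(\mathcal A)$), then the following are equivalent: (a) $\mathcal A$ has finite global dimension; (b) $\mathcal H(\mathbb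 T)$ has finite global dimension; (c) the smallest thick subcategory of $D(\mathcal A)$ containing $\operatorname{Add}(M)$ (respectively, $\operatorname{Prod}(M)$) is $D^b(\mathcal A)$. -/

import Mathlib

open CategoryTheory CategoryTheory.Limits CategoryTheory.Pretriangulated
open CategoryTheory.Triangulated
open scoped ZeroObject

universe w v u v' u'

set_option linter.unusedSectionVars false

noncomputable section

namespace TiltingHearts

/-! ### The heart of a t-structure is abelian -/

section Heart

variable {T : Type u} [Category.{v} T] [Preadditive T] [HasZeroObject T] [HasShift T ℤ]
  [∀ n : ℤ, (shiftFunctor T n).Additive] [Pretriangulated T] [IsTriangulated T]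

/-- The heart of a t-structure, as a full subcategory. -/
abbrev Heart (t : TStructure T) : Type u := t.heart.FullSubcategory

lemma heart_hom_shift_neg (t : TStructure T) ⦃X Y : Heart t⦄ ⦃n : ℤ⦄
    (f : t.heart.ι.obj X ⟶ (t.heart.ι.obj Y)⟦n⟧) (hn : n < 0) : f = 0 := by
  have h₁ : t.IsLE (t.heart.ι.obj X) 0 := ⟨X.2.1⟩
  have h₂ : t.IsGE (t.heart.ι.obj Y) 0 := ⟨Y.2.2⟩
  have h₃ : t.IsGE ((t.heart.ι.obj Y)⟦n⟧) (-n) := t.isGE_shift _ 0 n (-n)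
  exact t.zero f 0 (-n) (by lia)

lemma heart_admissible (t : TStructure T) :
    AbelianSubcategory.admissibleMorphism t.heart.ι = ⊤ := by
  ext X₁ X₂ f₁
  simp only [MorphismProperty.top_apply, iff_true]
  intro X₃ f₂ f₃ hT
  have a₁ : t.IsLE (t.heart.ι.obj X₁) 0 := ⟨X₁.2.1⟩
  have b₁ : t.IsGE (t.heart.ι.obj X₁) 0 := ⟨X₁.2.2⟩
  have a₂ : t.IsLE (t.heart.ι.obj X₂) 0 := ⟨X₂.2.1⟩
  have b₂ : t.IsGE (t.heart.ι.obj X₂) 0 := ⟨X₂.2.2⟩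
  have a₁' : t.IsLE ((t.heart.ι.obj X₁)⟦(1 : ℤ)⟧) (-1) := t.isLE_shift _ 0 1 (-1)
  have b₁' : t.IsGE ((t.heart.ι.obj X₁)⟦(1 : ℤ)⟧) (-1) := t.isGE_shift _ 0 1 (-1)
  have a₃ : t.IsLE X₃ 0 :=
    t.isLE₂ _ (rot_of_distTriang _ hT) 0 a₂
      (t.isLE_of_le ((t.heart.ι.obj X₁)⟦(1 : ℤ)⟧) (-1) 0)
  have b₃ : t.IsGE X₃ (-1) :=
    t.isGE₂ _ (rot_of_distTriang _ hT) (-1)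
      (t.isGE_of_ge (t.heart.ι.obj X₂) (-1) 0) b₁'
  have aK : t.IsLE ((t.truncLT 0).obj X₃) (-1) := t.isLE_truncLT_obj X₃ 0 (-1)
  have bK : t.IsGE ((t.truncLT 0).obj X₃) (-1) := inferInstance
  have aQ : t.IsLE ((t.truncGE 0).obj X₃) 0 := inferInstance
  have bQ : t.IsGE ((t.truncGE 0).obj X₃) 0 := inferInstance
  have aK' : t.IsLE (((t.truncLT 0).obj X₃)⟦(-1 : ℤ)⟧) 0 := t.isLE_shift _ (-1) (-1) 0
  have bK' : t.IsGE (((t.truncLT 0).obj X₃)⟦(-1 : ℤ)⟧) 0 := t.isGE_shift _ (-1) (-1) 0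
  let K : Heart t := ⟨((t.truncLT 0).obj X₃)⟦(-1 : ℤ)⟧, aK'.le, bK'.ge⟩
  let Q : Heart t := ⟨(t.truncGE 0).obj X₃, aQ.le, bQ.ge⟩
  let e : (t.heart.ι.obj K)⟦(1 : ℤ)⟧ ≅ (t.truncLT 0).obj X₃ :=
    (shiftFunctorCompIsoId T (-1 : ℤ) 1 (by lia)).app ((t.truncLT 0).obj X₃)
  refine ⟨K, Q, e.hom ≫ (t.truncLTι 0).app X₃, (t.truncGEπ 0).app X₃,
    (t.truncGEδLT 0).app X₃ ≫ e.inv⟦(1 : ℤ)⟧', ?_⟩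
  refine isomorphic_distinguished _ (t.triangleLTGE_distinguished 0 X₃) _ ?_
  refine Triangle.isoMk _ _ e (Iso.refl _) (Iso.refl _) (Category.comp_id _)
    ((Category.comp_id _).trans (Category.id_comp _).symm) ?_
  refine (Category.assoc _ _ _).trans (Eq.trans ?_ (Category.id_comp _).symm)
  refine Eq.trans ?_ (Category.comp_id _)
  exact congrArg _ (((shiftFunctor T (1 : ℤ)).map_comp _ _).symm.trans
    ((congrArg _ e.inv_hom_id).trans ((shiftFunctor T (1 : ℤ)).map_id _)))

instance (t : TStructure T) : t.heart.ContainsZero where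
  exists_zero := ⟨0, isZero_zero T, (inferInstance : t.IsLE (0 : T) 0).le,
    (inferInstance : t.IsGE (0 : T) 0).ge⟩

instance (t : TStructure T) : t.heart.IsClosedUnderBinaryProducts where
  limitsOfShape_le := by
    rintro X ⟨p⟩
    have h₁ := p.prop_diag_obj (.mk .left)
    have h₂ := p.prop_diag_obj (.mk .right)
    refine t.heart.prop_of_iso (IsLimit.conePointUniqueUpToIso (prodIsProd _ _)
      ((IsLimit.postcomposeHomEquiv (diagramIsoPair p.diag) _).2 p.isLimit)) ?_
    have hT := binaryProductTriangle_distinguished (p.diag.obj (.mk .left)) (p.diag.obj (.mk .right))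
    exact ⟨(t.isLE₂ _ hT 0 ⟨h₁.1⟩ ⟨h₂.1⟩).le, (t.isGE₂ _ hT 0 ⟨h₁.2⟩ ⟨h₂.2⟩).ge⟩

instance (t : TStructure T) : t.heart.IsClosedUnderFiniteProducts := .mk'

instance heartAbelian (t : TStructure T) : Abelian (Heart t) :=
  AbelianSubcategory.abelian t.heart.ι (heart_hom_shift_neg t) (heart_admissible t)

end Heart

/-! ### Bounded complexes, the bounded derived category, global dimension -/

section Abelian

variable (C : Type u) [Category.{v} C] [Abelian C]

/-- Bounded cochain complexes. -/
def boundedComplex : ObjectProperty (CochainComplex C ℤ) :=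
  fun K ↦ ∃ a b : ℤ, K.IsStrictlyGE a ∧ K.IsStrictlyLE b

/-- The category `C^b` of bounded cochain complexes. -/
abbrev BoundedComplex : Type (max u v) := (boundedComplex C).FullSubcategory

/-- The objects of the derived category with bounded cohomology. -/
abbrev boundedDerived [HasDerivedCategory.{w} C] : ObjectProperty (DerivedCategory C) :=
  (DerivedCategory.TStructure.t (C := C)).bounded

/-- The bounded derived category `D^b`, as the full subcategory of the derived category of the
complexes with bounded cohomology. -/
abbrev BoundedDerivedCategory [HasDerivedCategory.{w} C] : Type (max u v) :=
  (boundedDerived C).FullSubcategory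

/-- The localisation functor `C^b ⥤ D^b`. -/
def boundedQ [HasDerivedCategory.{w} C] : BoundedComplex C ⥤ BoundedDerivedCategory C :=
  (boundedDerived C).lift ((boundedComplex C).ι ⋙ DerivedCategory.Q) (by
    rintro ⟨K, a, b, ha, hb⟩
    exact ⟨⟨a, (inferInstance : (DerivedCategory.Q.obj K).IsGE a)⟩,
      ⟨b, (inferInstance : (DerivedCategory.Q.obj K).IsLE b)⟩⟩)

/-- `C` has finite global dimension: some `Ext^n(-,-)` with `n > 0` vanishes identically. -/
def HasFiniteGlobalDimension : Prop :=
  have := HasExt.standard C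
  ∃ n : ℕ, 0 < n ∧ ∀ X Y : C, Subsingleton (Abelian.Ext X Y n)

/-- `C` has a projective generator. -/
def HasProjectiveGenerator : Prop := ∃ P : C, Projective P ∧ IsSeparator P

/-- `C` has an injective cogenerator. -/
def HasInjectiveCogenerator : Prop := ∃ E : C, Injective E ∧ IsCoseparator E

end Abelian

/-! ### Silting, cosilting, tilting and cotilting objects -/

section Tilting

variable {T : Type u} [Category.{v} T] [Preadditive T] [HasZeroObject T] [HasShift T ℤ]
  [∀ n : ℤ, (shiftFunctor T n).Additive] [Pretriangulated T]

/-- `Add M`: the summands of the (existing) set-indexed coproducts of copies of `M`. -/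
def add (M : T) : ObjectProperty T :=
  fun X ↦ ∃ (I : Type v) (c : Cofan (fun _ : I ↦ M)),
    Nonempty (IsColimit c) ∧ Nonempty (Retract X c.pt)

/-- `Prod M`: the summands of the (existing) set-indexed products of copies of `M`. -/
def prod (M : T) : ObjectProperty T :=
  fun X ↦ ∃ (I : Type v) (c : Fan (fun _ : I ↦ M)),
    Nonempty (IsLimit c) ∧ Nonempty (Retract X c.pt)

/-- `M^{⊥_I}`: the objects `Y` with `Hom(M, Y[i]) = 0` for all `i ∈ I`. -/
def rightPerp (M : T) (I : Set ℤ) : ObjectProperty T :=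
  fun Y ↦ ∀ i ∈ I, ∀ f : M ⟶ Y⟦i⟧, f = 0

/-- `^{⊥_I}M`: the objects `Y` with `Hom(Y, M[i]) = 0` for all `i ∈ I`. -/
def leftPerp (M : T) (I : Set ℤ) : ObjectProperty T :=
  fun Y ↦ ∀ i ∈ I, ∀ f : Y ⟶ M⟦i⟧, f = 0

/-- `t` is the t-structure `(M^{⊥_{>0}}, M^{⊥_{<0}})`. -/
def IsSiltingTStructure (M : T) (t : TStructure T) : Prop :=
  t.le 0 = rightPerp M (Set.Ioi 0) ∧ t.ge 0 = rightPerp M (Set.Iio 0)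

/-- `t` is the t-structure `(^{⊥_{<0}}M, ^{⊥_{>0}}M)`. -/
def IsCosiltingTStructure (M : T) (t : TStructure T) : Prop :=
  t.le 0 = leftPerp M (Set.Iio 0) ∧ t.ge 0 = leftPerp M (Set.Ioi 0)

/-- Silting objects. -/
def IsSilting (M : T) : Prop :=
  (∃ t : TStructure T, IsSiltingTStructure M t) ∧ rightPerp M (Set.Ioi 0) M

/-- Cosilting objects. -/
def IsCosilting (M : T) : Prop :=
  (∃ t : TStructure T, IsCosiltingTStructure M t) ∧ leftPerp M (Set.Ioi 0) M

/-- Tilting objects. -/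
def IsTilting (M : T) : Prop := IsSilting M ∧ add M ≤ rightPerp M {0}ᶜ

/-- Cotilting objects. -/
def IsCotilting (M : T) : Prop := IsCosilting M ∧ prod M ≤ leftPerp M {0}ᶜ

/-- The smallest thick subcategory (triangulated subcategory closed under direct summands)
containing `P`. -/
def thick (P : ObjectProperty T) : ObjectProperty T :=
  fun X ↦ ∀ Q : ObjectProperty T, Q.IsTriangulated → Q.IsStableUnderRetracts → P ≤ Q → Q X

end Tilting

/-! ### f-categories -/

section FCategory

variable (X : Type u') [Category.{v'} X] [Preadditive X] [HasZeroObject X] [HasShift X ℤ]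
  [∀ n : ℤ, (shiftFunctor X n).Additive] [Pretriangulated X] [IsTriangulated X]

/-- An f-category structure on the triangulated category `X`: a triangulated autoequivalence `s`
(the f-shift), a natural transformation `α : 𝟭 ⟶ s`, and strictly full triangulated
subcategories `X(≥ n) = s^n X(≥ 0)` (`ge n`) and `X(≤ n) = s^n X(≤ 0)` (`le n`), subject to the
axioms below. Because `s` is an autoequivalence with `s X(≥ n) = X(≥ n + 1)` and
`s X(≤ n) = X(≤ n + 1)`, the axioms quantified over `n` amount to their instances at `n = 0`. -/
structure FCategory where
  /-- the f-shift -/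
  s : X ≌ X
  commShift : s.functor.CommShift ℤ
  isTriangulated : s.functor.IsTriangulated
  /-- the natural transformation from the identity to the f-shift -/
  α : 𝟭 X ⟶ s.functor
  /-- the subcategories `X(≥ n)` -/
  ge : ℤ → ObjectProperty X
  /-- the subcategories `X(≤ n)` -/
  le : ℤ → ObjectProperty X
  ge_iso (n : ℤ) : (ge n).IsClosedUnderIsomorphisms
  le_iso (n : ℤ) : (le n).IsClosedUnderIsomorphisms
  ge_triangulated (n : ℤ) : (ge n).IsTriangulated
  le_triangulated (n : ℤ) : (le n).IsTriangulated
  ge_s_iff (n : ℤ) (A : X) : ge (n + 1) (s.functor.obj A) ↔ ge n A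
  le_s_iff (n : ℤ) (A : X) : le (n + 1) (s.functor.obj A) ↔ le n A
  zero (n : ℤ) ⦃A B : X⦄ (f : A ⟶ B) (hA : ge (n + 1) A) (hB : le n B) : f = 0
  exists_triangle (n : ℤ) (A : X) : ∃ (B D : X) (_ : ge (n + 1) B) (_ : le n D)
    (f : B ⟶ A) (g : A ⟶ D) (h : D ⟶ B⟦(1 : ℤ)⟧), Triangle.mk f g h ∈ distTriang X
  exhaustive (A : X) : (∃ n, ge n A) ∧ (∃ n, le n A)
  ge_succ_le (n : ℤ) : ge (n + 1) ≤ ge n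
  le_le_succ (n : ℤ) : le n ≤ le (n + 1)
  α_s (A : X) : α.app (s.functor.obj A) = s.functor.map (α.app A)
  bijective_α_comp ⦃A B : X⦄ (hA : ge 1 A) (hB : le 0 B) :
    Function.Bijective (fun f : s.functor.obj B ⟶ A ↦ α.app B ≫ f)
  bijective_comp_α ⦃A B : X⦄ (hA : ge 1 A) (hB : le 0 B) :
    Function.Bijective (fun f : B ⟶ A ↦ f ≫ α.app A)

attribute [instance] FCategory.commShift FCategory.isTriangulated FCategory.ge_iso
  FCategory.le_iso FCategory.ge_triangulated FCategory.le_triangulated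

namespace FCategory

variable {X} (F : FCategory X)

/-- The stable t-structure `(X(≥ n), X(≤ n - 1))`. -/
def stable (n : ℤ) : TStructure X where
  le _ := F.ge n
  ge _ := F.le (n - 1)
  le_shift _ a _ _ _ hA := (F.ge n).le_shift a _ hA
  ge_shift _ a _ _ _ hA := (F.le (n - 1)).le_shift a _ hA
  zero' _ _ f hA hB := F.zero (n - 1) f (by simpa using hA) hB
  le_zero_le := le_rfl
  ge_one_le := le_rfl
  exists_triangle_zero_one A := by
    simpa using F.exists_triangle (n - 1) A

/-- The truncation functor `σ_{≥ n}`, right adjoint to the inclusion of `X(≥ n)`. -/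
def σGE (n : ℤ) : X ⥤ X := (F.stable n).truncLT 0

/-- The truncation functor `σ_{≤ n}`, left adjoint to the inclusion of `X(≤ n)`. -/
def σLE (n : ℤ) : X ⥤ X := (F.stable (n + 1)).truncGE 0

/-- The canonical morphism `σ_{≥ n} A ⟶ A`. -/
def σGEι (n : ℤ) : F.σGE n ⟶ 𝟭 X := (F.stable n).truncLTι 0

/-- The canonical morphism `A ⟶ σ_{≤ n} A`. -/
def σLEπ (n : ℤ) : 𝟭 X ⟶ F.σLE n := (F.stable (n + 1)).truncGEπ 0

/-- The connecting morphism of the triangle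
`σ_{≥ n + 1} A ⟶ A ⟶ σ_{≤ n} A ⟶ (σ_{≥ n + 1} A)[1]`. -/
def σδ (n : ℤ) : F.σLE n ⟶ F.σGE (n + 1) ⋙ shiftFunctor X (1 : ℤ) :=
  (F.stable (n + 1)).truncGEδLT 0

/-- The functor `σ_{≤ n} σ_{≥ n}`. -/
def slice (n : ℤ) : X ⥤ X := F.σGE n ⋙ F.σLE n

/-- The morphism `σ_{≤ n} σ_{≥ n} A ⟶ (σ_{≤ n + 1} σ_{≥ n + 1} A)[1]`, which is the composition
`σ_{≤ n} σ_{≥ n} A ⟶ (σ_{≥ n + 1} σ_{≥ n} A)[1] ≅ (σ_{≥ n + 1} A)[1] ⟶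
(σ_{≤ n + 1} σ_{≥ n + 1} A)[1]`; it is the connecting morphism of the triangle
`σ_{≤ n + 1} σ_{≥ n + 1} A ⟶ σ_{≤ n + 1} σ_{≥ n} A ⟶ σ_{≤ n} σ_{≥ n} A ⟶`. -/
def sliceδ (n : ℤ) : F.slice n ⟶ F.slice (n + 1) ⋙ shiftFunctor X (1 : ℤ) :=
  Functor.whiskerLeft (F.σGE n) (F.σδ n) ≫
    Functor.whiskerRight
      (Functor.whiskerRight (F.σGEι n) (F.σGE (n + 1)) ≫ (Functor.leftUnitor _).hom ≫
        (Functor.rightUnitor _).inv ≫ Functor.whiskerLeft (F.σGE (n + 1)) (F.σLEπ (n + 1)))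
      (shiftFunctor X (1 : ℤ))

lemma sliceδ_comp (n : ℤ) (A : X) :
    (F.sliceδ n).app A ≫ ((F.sliceδ (n + 1)).app A)⟦(1 : ℤ)⟧' = 0 := by
  have h₀ : (F.σLEπ (n + 1)).app ((F.σGE (n + 1)).obj A) ≫
      (F.σδ (n + 1)).app ((F.σGE (n + 1)).obj A) = 0 :=
    (F.stable (n + 1 + 1)).truncGEπ_comp_truncGEδLT_app 0 _
  have h : (F.σLEπ (n + 1)).app ((F.σGE (n + 1)).obj A) ≫ (F.sliceδ (n + 1)).app A = 0 :=
    (Category.assoc _ _ _).symm.trans ((congrArg (· ≫ _) h₀).trans zero_comp)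
  have h' : ((F.σLEπ (n + 1)).app ((F.σGE (n + 1)).obj A))⟦(1 : ℤ)⟧' ≫
      ((F.sliceδ (n + 1)).app A)⟦(1 : ℤ)⟧' = 0 :=
    ((shiftFunctor X (1 : ℤ)).map_comp _ _).symm.trans
      ((congrArg (shiftFunctor X (1 : ℤ)).map h).trans (Functor.map_zero _ _ _))
  have e : (F.sliceδ n).app A = ((F.σδ n).app ((F.σGE n).obj A) ≫
      ((F.σGE (n + 1)).map ((F.σGEι n).app A))⟦(1 : ℤ)⟧') ≫
        ((F.σLEπ (n + 1)).app ((F.σGE (n + 1)).obj A))⟦(1 : ℤ)⟧' := by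
    refine Eq.trans ?_ (Category.assoc _ _ _).symm
    refine congrArg (_ ≫ ·) (Eq.trans ?_ ((shiftFunctor X (1 : ℤ)).map_comp _ _))
    refine congrArg (shiftFunctor X (1 : ℤ)).map (congrArg (_ ≫ ·) ?_)
    exact (Category.id_comp _).trans (Category.id_comp _)
  rw [e]
  exact (Category.assoc _ _ _).trans ((congrArg (_ ≫ ·) h').trans comp_zero)

lemma ge_antitone {n m : ℤ} (h : n ≤ m) : F.ge m ≤ F.ge n :=
  antitone_int_of_succ_le F.ge_succ_le h

lemma le_monotone {n m : ℤ} (h : n ≤ m) : F.le n ≤ F.le m :=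
  monotone_int_of_le_succ F.le_le_succ h

lemma isZero_slice_of_ge (n m : ℤ) (h : n < m) (A : X) (hA : F.ge m A) :
    IsZero ((F.slice n).obj A) := by
  have h₁ : (F.stable n).IsLE A (-1) := ⟨F.ge_antitone h.le _ hA⟩
  have h₂ : IsIso (((F.stable n).truncLTι 0).app A) :=
    ((F.stable n).isLE_iff_isIso_truncLTι_app (-1) 0 (by lia) A).1 h₁
  have h₃ : (F.stable (n + 1)).IsLE ((F.σGE n).obj A) (-1) :=
    ⟨(F.ge (n + 1)).prop_of_iso (asIso (((F.stable n).truncLTι 0).app A)).symm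
      (F.ge_antitone (by lia) _ hA)⟩
  exact (F.stable (n + 1)).isZero_truncGE_obj_of_isLE (-1) 0 (by lia) _

lemma isZero_slice_of_le (n m : ℤ) (h : m < n) (A : X) (hA : F.le m A) :
    IsZero ((F.slice n).obj A) := by
  have h₁ : (F.stable n).IsGE A 0 := ⟨F.le_monotone (by lia) _ hA⟩
  have h₂ : IsZero ((F.σGE n).obj A) := (F.stable n).isZero_truncLT_obj_of_isGE 0 A
  exact Functor.map_isZero ((F.stable (n + 1)).truncGE 0) h₂

end FCategory

end FCategory

/-! ### f-categories over a triangulated category and realisation functors -/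

section Realisation

variable {T : Type u} [Category.{v} T] [Preadditive T] [HasZeroObject T] [HasShift T ℤ]
  [∀ n : ℤ, (shiftFunctor T n).Additive] [Pretriangulated T] [IsTriangulated T]
  {X : Type u'} [Category.{v'} X] [Preadditive X] [HasZeroObject X] [HasShift X ℤ]
  [∀ n : ℤ, (shiftFunctor X n).Additive] [Pretriangulated X] [IsTriangulated X]

variable (T X) in
/-- An f-category over `T` (f-enhancement of `T`): an f-category `X` together with a triangle
equivalence `θ` between `T` and `X(≥ 0) ∩ X(≤ 0)`. -/
structure FEnhancement extends FCategory X where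
  /-- the equivalence, as a functor to `X` -/
  θ : T ⥤ X
  commShift_θ : θ.CommShift ℤ
  isTriangulated_θ : θ.IsTriangulated
  full_θ : θ.Full
  faithful_θ : θ.Faithful
  essImage_θ : θ.essImage = ge 0 ⊓ le 0

attribute [instance] FEnhancement.commShift_θ FEnhancement.isTriangulated_θ
  FEnhancement.full_θ FEnhancement.faithful_θ

namespace FEnhancement

variable (E : FEnhancement T X)

lemma ge_θ (Y : T) : E.ge 0 (E.θ.obj Y) :=
  (E.essImage_θ ▸ E.θ.obj_mem_essImage Y : (E.ge 0 ⊓ E.le 0) _).1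

lemma le_θ (Y : T) : E.le 0 (E.θ.obj Y) :=
  (E.essImage_θ ▸ E.θ.obj_mem_essImage Y : (E.ge 0 ⊓ E.le 0) _).2

end FEnhancement

/-- An f-forgetful functor `ω : X ⥤ T` for an f-category over `T`. -/
structure ForgetfulFunctor (E : FEnhancement T X) where
  /-- the functor -/
  ω : X ⥤ T
  commShift_ω : ω.CommShift ℤ
  isTriangulated_ω : ω.IsTriangulated
  /-- on `X(≥ 0)`, `ω` is right adjoint to `θ` -/
  adj_ge : Nonempty ((E.ge 0).lift E.θ E.ge_θ ⊣ (E.ge 0).ι ⋙ ω)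
  /-- on `X(≤ 0)`, `ω` is left adjoint to `θ` -/
  adj_le : Nonempty ((E.le 0).ι ⋙ ω ⊣ (E.le 0).lift E.θ E.le_θ)
  isIso_map_α (A : X) : IsIso (ω.map (E.α.app A))
  bijective_map ⦃A B : X⦄ (hA : E.le 0 A) (hB : E.ge 0 B) :
    Function.Bijective (fun f : A ⟶ B ↦ ω.map f)

attribute [instance] ForgetfulFunctor.commShift_ω ForgetfulFunctor.isTriangulated_ω

namespace ForgetfulFunctor

variable {E : FEnhancement T X} (W : ForgetfulFunctor E)

/-- The functor `gr^n = ω σ_{≤ n} σ_{≥ n}`. By the properties of `ω` it is naturally isomorphic to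
`θ⁻¹ s⁻ⁿ σ_{≤ n} σ_{≥ n}`. -/
def gr (n : ℤ) : X ⥤ T := E.slice n ⋙ W.ω

/-- The connecting morphism `gr^n A ⟶ (gr^{n + 1} A)[1]`. -/
def grδ (n : ℤ) : W.gr n ⟶ W.gr (n + 1) ⋙ shiftFunctor T (1 : ℤ) :=
  Functor.whiskerRight (E.sliceδ n) W.ω ≫
    Functor.whiskerLeft (E.slice (n + 1)) (W.ω.commShiftIso (1 : ℤ)).hom

lemma grδ_comp (n : ℤ) (A : X) :
    (W.grδ n).app A ≫ ((W.grδ (n + 1)).app A)⟦(1 : ℤ)⟧' = 0 := by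
  have h₁ : W.ω.map ((E.sliceδ n).app A) ≫
      W.ω.map (((E.sliceδ (n + 1)).app A)⟦(1 : ℤ)⟧') = 0 :=
    (W.ω.map_comp _ _).symm.trans ((congrArg W.ω.map (E.sliceδ_comp n A)).trans
      (Functor.map_zero _ _ _))
  have h₂ : W.ω.map (((E.sliceδ (n + 1)).app A)⟦(1 : ℤ)⟧') ≫
      (W.ω.commShiftIso (1 : ℤ)).hom.app _ = (W.ω.commShiftIso (1 : ℤ)).hom.app _ ≫
        (W.ω.map ((E.sliceδ (n + 1)).app A))⟦(1 : ℤ)⟧' :=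
    (W.ω.commShiftIso (1 : ℤ)).hom.naturality ((E.sliceδ (n + 1)).app A)
  have e : ((W.grδ (n + 1)).app A)⟦(1 : ℤ)⟧' =
      (W.ω.map ((E.sliceδ (n + 1)).app A))⟦(1 : ℤ)⟧' ≫
        ((W.ω.commShiftIso (1 : ℤ)).hom.app ((E.slice (n + 1 + 1)).obj A))⟦(1 : ℤ)⟧' :=
    (shiftFunctor T (1 : ℤ)).map_comp _ _
  have e' : (W.grδ n).app A = W.ω.map ((E.sliceδ n).app A) ≫
      (W.ω.commShiftIso (1 : ℤ)).hom.app ((E.slice (n + 1)).obj A) := rfl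
  rw [e]
  refine (congrArg (· ≫ _) e').trans ?_
  refine (Category.assoc _ _ _).trans ?_
  refine (congrArg (_ ≫ ·) ((Category.assoc _ _ _).symm.trans
    ((congrArg (· ≫ _) h₂.symm).trans (Category.assoc _ _ _)))).trans ?_
  exact (Category.assoc _ _ _).symm.trans ((congrArg (· ≫ _) h₁).trans zero_comp)

/-- The morphism `(gr^n A)[n] ⟶ (gr^{n + 1} A)[n + 1]` obtained by shifting the connecting
morphism. -/
def d (n : ℤ) : W.gr n ⋙ shiftFunctor T n ⟶ W.gr (n + 1) ⋙ shiftFunctor T (n + 1) :=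
  Functor.whiskerRight (W.grδ n) (shiftFunctor T n) ≫
    Functor.whiskerLeft (W.gr (n + 1)) (shiftFunctorAdd' T 1 n (n + 1) (add_comm 1 n)).inv

lemma d_comp_d (n : ℤ) (A : X) : (W.d n).app A ≫ (W.d (n + 1)).app A = 0 := by
  have h₁ : ((W.grδ n).app A)⟦n⟧' ≫ (((W.grδ (n + 1)).app A)⟦(1 : ℤ)⟧')⟦n⟧' = 0 :=
    ((shiftFunctor T n).map_comp _ _).symm.trans
      ((congrArg (shiftFunctor T n).map (W.grδ_comp n A)).trans (Functor.map_zero _ _ _))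
  have h₂ : (((W.grδ (n + 1)).app A)⟦(1 : ℤ)⟧')⟦n⟧' ≫
      (shiftFunctorAdd' T 1 n (n + 1) (add_comm 1 n)).inv.app _ =
        (shiftFunctorAdd' T 1 n (n + 1) (add_comm 1 n)).inv.app _ ≫
          ((W.grδ (n + 1)).app A)⟦n + 1⟧' :=
    (shiftFunctorAdd' T 1 n (n + 1) (add_comm 1 n)).inv.naturality _
  refine (Category.assoc _ _ _).trans ?_
  refine (congrArg (_ ≫ ·) ((Category.assoc _ _ _).symm.trans
    ((congrArg (· ≫ _) h₂.symm).trans (Category.assoc _ _ _)))).trans ?_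
  exact (Category.assoc _ _ _).symm.trans ((congrArg (· ≫ _) h₁).trans zero_comp)

variable (t : TStructure T)

/-- The heart of the t-structure on `X` with `X^{≤ 0} = {A | gr^n A ∈ T^{≤ n} for all n}` and
`X^{≥ 0} = {A | gr^n A ∈ T^{≥ n} for all n}`. -/
def fHeart : ObjectProperty X :=
  fun A ↦ ∀ n : ℤ, t.le n ((W.gr n).obj A) ∧ t.ge n ((W.gr n).obj A)

/-- The object `H^n(gr^n A)` of the heart of `t`, for `A` in the heart of `X`; since
`gr^n A` is concentrated in degree `n`, it is `(gr^n A)[n]`. -/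
def heartObj (A : (W.fHeart t).FullSubcategory) (n : ℤ) : Heart t :=
  ⟨((W.gr n).obj A.obj)⟦n⟧, t.le_shift n n 0 (add_zero n) _ (A.property n).1,
    t.ge_shift n n 0 (add_zero n) _ (A.property n).2⟩

/-- The differential `H^n(gr^n A) ⟶ H^{n + 1}(gr^{n + 1} A)`. -/
def heartD (A : (W.fHeart t).FullSubcategory) (n : ℤ) :
    W.heartObj t A n ⟶ W.heartObj t A (n + 1) :=
  ObjectProperty.homMk ((W.d n).app A.obj)

/-- The complex with components `H^n(gr^n A)` attached to an object `A` of the heart of `X`. -/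
def heartComplex (A : (W.fHeart t).FullSubcategory) : CochainComplex (Heart t) ℤ :=
  CochainComplex.of (W.heartObj t A) (W.heartD t A)
    (fun n ↦ ObjectProperty.hom_ext _ (W.d_comp_d n A.obj))

/-- The morphism of complexes induced by a morphism in the heart of `X`. -/
def heartMap {A B : (W.fHeart t).FullSubcategory} (f : A ⟶ B) :
    W.heartComplex t A ⟶ W.heartComplex t B :=
  CochainComplex.ofHom (fun n ↦ ObjectProperty.homMk (((W.gr n).map f.hom)⟦n⟧')) (fun n ↦
    have hA := CochainComplex.of_d (W.heartObj t A) (W.heartD t A) n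
    have hB := CochainComplex.of_d (W.heartObj t B) (W.heartD t B) n
    (congrArg (_ ≫ ·) hB).trans ((ObjectProperty.hom_ext _ ((W.d n).naturality f.hom)).trans
      (congrArg (· ≫ _) hA.symm)))

lemma isZero_heartObj (A : (W.fHeart t).FullSubcategory) (n : ℤ)
    (h : IsZero ((E.slice n).obj A.obj)) : IsZero (W.heartObj t A n) := by
  have h' : IsZero (t.heart.ι.obj (W.heartObj t A n)) :=
    Functor.map_isZero (shiftFunctor T n) (Functor.map_isZero W.ω h)
  exact h'.of_full_of_faithful_of_isZero t.heart.ι _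

lemma boundedComplex_heartComplex (A : (W.fHeart t).FullSubcategory) :
    boundedComplex (Heart t) (W.heartComplex t A) := by
  obtain ⟨⟨a, ha⟩, ⟨b, hb⟩⟩ := E.exhaustive A.obj
  exact ⟨a, b, (CochainComplex.isStrictlyGE_iff _ _).2 fun i hi ↦
      W.isZero_heartObj t A i (E.isZero_slice_of_ge i a hi _ ha),
    (CochainComplex.isStrictlyLE_iff _ _).2 fun i hi ↦
      W.isZero_heartObj t A i (E.isZero_slice_of_le i b hi _ hb)⟩

/-- The functor from the heart of `X` to the bounded complexes over the heart of `t`, sending `A`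
to the complex with components `H^n(gr^n A)`. -/
def H0 : (W.fHeart t).FullSubcategory ⥤ BoundedComplex (Heart t) where
  obj A := ⟨W.heartComplex t A, W.boundedComplex_heartComplex t A⟩
  map f := ObjectProperty.homMk (W.heartMap t f)
  map_id A := by
    refine ObjectProperty.hom_ext _ (HomologicalComplex.hom_ext _ _ fun n ↦
      ObjectProperty.hom_ext _ ?_)
    exact (congrArg (shiftFunctor T n).map ((W.gr n).map_id _)).trans
      ((shiftFunctor T n).map_id _)
  map_comp f g := by
    refine ObjectProperty.hom_ext _ (HomologicalComplex.hom_ext _ _ fun n ↦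
      ObjectProperty.hom_ext _ ?_)
    exact (congrArg (shiftFunctor T n).map ((W.gr n).map_comp _ _)).trans
      ((shiftFunctor T n).map_comp _ _)

/-- `real : D^b(Heart t) ⥤ T` is a realisation functor of `t` (with respect to the given f-category
over `T` and f-forgetful functor): for a quasi-inverse `G` of the equivalence `H0`, the functor
`ω ∘ G` factors as `real ∘ Q` up to isomorphism. -/
def IsRealisation [HasDerivedCategory.{w} (Heart t)]
    (real : BoundedDerivedCategory (Heart t) ⥤ T) : Prop :=
  ∃ G : BoundedComplex (Heart t) ⥤ (W.fHeart t).FullSubcategory,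
    Nonempty (W.H0 t ⋙ G ≅ 𝟭 _) ∧ Nonempty (G ⋙ W.H0 t ≅ 𝟭 _) ∧
      Nonempty (boundedQ (Heart t) ⋙ real ≅ G ⋙ (W.fHeart t).ι ⋙ W.ω)

end ForgetfulFunctor

end Realisation

end TiltingHearts

end

noncomputable section

namespace TiltingHearts

/-! ### Vanishing of morphisms -/

section HomVanish

variable {T : Type u} [Category.{v} T] [Preadditive T]

/-! Everything is measured in the ambient triangulated category: instead of Ext in a heart, the
proof works with `HeartVanish t n`, the vanishing of Hom(X, Y[n]) for X, Y in the heart of t.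

The core is a symmetric comparison, `exists_heartVanish_of_heartVanish`. Let t be the t-structure of
a tilting object M, with heart vanishing in degree d + 1, and let t' have the same bounded objects.
Add(M) consists of enough projectives of the heart of t, so every object of that heart has a
resolution of length at most d by Add(M). Since Add(M) is bounded for t', one huge coproduct shows
that it is uniformly bounded, say in degrees [a, b]. Splicing resolutions puts the heart of t in
t'-degrees at least a - d, and orthogonality then confines the heart of t' to the t-degrees [-b, d -
a]. Morphisms between objects of this range vanish in all large degrees.

A projective generator P of the abelian category is itself tilting for the standard t-structure. The
delicate point is that coproducts of copies of P taken in the derived category stay in the heart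
(`IsProjGenerator.add_le_rightPerp`). So the comparison applies with P as M, giving (1) and (a) ⇒
(b), and with the given tilting object as M, giving (b) ⇒ (a). For (b) ⇔ (c), finite resolutions
generate; conversely thick generation bounds the dimension of each object, and a coproduct makes the
bound uniform.

Finally `HeartVanish` is turned into Ext of the heart: by dimension shifting if there are enough
projectives or injectives, and by faithfulness of the realisation functor in (1). The dual
statements come from the opposite triangulated category. -/

/-- All morphisms from `X` to `Y` are zero. -/
def HomVanish (X Y : T) : Prop := ∀ f : X ⟶ Y, f = 0

lemma HomVanish.of_retract_left {X X' Y : T} (h : HomVanish X' Y) (r : Retract X X') :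
    HomVanish X Y := fun f ↦ by
  have := h (r.r ≫ f)
  rw [← Category.id_comp f, ← r.retract, Category.assoc, this, comp_zero]

lemma HomVanish.of_retract_right {X Y Y' : T} (h : HomVanish X Y') (r : Retract Y Y') :
    HomVanish X Y := fun f ↦ by
  have := h (f ≫ r.i)
  rw [← Category.comp_id f, ← r.retract, ← Category.assoc, this, zero_comp]

lemma homVanish_iff_of_iso_left {X X' Y : T} (e : X ≅ X') : HomVanish X Y ↔ HomVanish X' Y :=
  ⟨fun h ↦ h.of_retract_left (Retract.ofIso e.symm), fun h ↦ h.of_retract_left (Retract.ofIso e)⟩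

lemma homVanish_iff_of_iso_right {X Y Y' : T} (e : Y ≅ Y') : HomVanish X Y ↔ HomVanish X Y' :=
  ⟨fun h ↦ h.of_retract_right (Retract.ofIso e.symm), fun h ↦ h.of_retract_right (Retract.ofIso e)⟩

lemma HomVanish.isZero {X : T} (h : HomVanish X X) : IsZero X :=
  (IsZero.iff_id_eq_zero _).2 (h _)

lemma homVanish_of_isZero_left {X Y : T} (h : IsZero X) : HomVanish X Y :=
  fun _ ↦ h.eq_of_src _ _

lemma homVanish_of_isZero_right {X Y : T} (h : IsZero Y) : HomVanish X Y :=
  fun _ ↦ h.eq_of_tgt _ _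

/-- A coproduct has no nonzero morphism to `Y` if none of the terms has. -/
lemma HomVanish.of_isColimit {I : Type*} {F : I → T} {Y : T} (h : ∀ i, HomVanish (F i) Y)
    {c : Cofan F} (hc : IsColimit c) : HomVanish c.pt Y := fun _ ↦
  Cofan.IsColimit.hom_ext hc _ _ fun i ↦ (h i _).trans comp_zero.symm

/-! ### Vanishing of morphisms under shifts and along triangles. -/

section Shift

variable [HasShift T ℤ] [∀ n : ℤ, (shiftFunctor T n).Additive]

lemma homVanish_shift_shift_iff (X Y : T) (a : ℤ) :
    HomVanish (X⟦a⟧) (Y⟦a⟧) ↔ HomVanish X Y := by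
  constructor
  · intro h f
    exact (shiftFunctor T a).map_injective ((h _).trans (Functor.map_zero _ _ _).symm)
  · intro h f
    obtain ⟨g, rfl⟩ := (shiftFunctor T a).map_surjective f
    rw [h g, Functor.map_zero]

lemma homVanish_shift_iff (X Y : T) (a b c : ℤ) (h : a + c = b) :
    HomVanish (X⟦a⟧) (Y⟦b⟧) ↔ HomVanish X (Y⟦c⟧) := by
  rw [homVanish_iff_of_iso_right ((shiftFunctorAdd' T c a b (by lia)).app Y)]
  exact homVanish_shift_shift_iff _ _ _

lemma homVanish_shift_left_iff (X Y : T) (a b : ℤ) (h : a + b = 0) :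
    HomVanish (X⟦a⟧) Y ↔ HomVanish X (Y⟦b⟧) := by
  rw [← homVanish_shift_iff X Y a 0 b h]
  exact homVanish_iff_of_iso_right ((shiftFunctorZero T ℤ).symm.app Y)

lemma homVanish_shift_add_iff (X Y : T) (a b c : ℤ) (h : a + b = c) :
    HomVanish X (Y⟦a⟧⟦b⟧) ↔ HomVanish X (Y⟦c⟧) :=
  (homVanish_iff_of_iso_right ((shiftFunctorAdd' T a b c h).app Y)).symm

lemma homVanish_shift_zero_iff (X Y : T) : HomVanish X (Y⟦(0 : ℤ)⟧) ↔ HomVanish X Y :=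
  homVanish_iff_of_iso_right ((shiftFunctorZero T ℤ).app Y)

section Triangles

variable [HasZeroObject T] [Pretriangulated T] {D : Triangle T} (hD : D ∈ distTriang T)
include hD

lemma HomVanish.to_obj₂ {W : T} (h₁ : HomVanish W D.obj₁) (h₃ : HomVanish W D.obj₃) :
    HomVanish W D.obj₂ := fun f ↦ by
  obtain ⟨g, rfl⟩ := Triangle.coyoneda_exact₂ _ hD f (h₃ _)
  rw [h₁ g, zero_comp]

lemma HomVanish.from_obj₂ {W : T} (h₁ : HomVanish D.obj₁ W) (h₃ : HomVanish D.obj₃ W) :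
    HomVanish D.obj₂ W := fun f ↦ by
  obtain ⟨g, rfl⟩ := Triangle.yoneda_exact₂ _ hD f (h₁ _)
  rw [h₃ g, comp_zero]

lemma HomVanish.to_shift_obj₂ {W : T} {n : ℤ} (h₁ : HomVanish W (D.obj₁⟦n⟧))
    (h₃ : HomVanish W (D.obj₃⟦n⟧)) : HomVanish W (D.obj₂⟦n⟧) :=
  HomVanish.to_obj₂ (Triangle.shift_distinguished _ hD n) h₁ h₃

lemma HomVanish.to_shift_obj₃ {W : T} {n m : ℤ} (h : n + 1 = m)
    (h₂ : HomVanish W (D.obj₂⟦n⟧)) (h₁ : HomVanish W (D.obj₁⟦m⟧)) : HomVanish W (D.obj₃⟦n⟧) :=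
  HomVanish.to_shift_obj₂ (rot_of_distTriang _ hD) h₂
    ((homVanish_shift_add_iff _ _ 1 n m (by lia)).2 h₁)

lemma HomVanish.to_shift_obj₁ {W : T} {n m : ℤ} (h : n + 1 = m)
    (h₃ : HomVanish W (D.obj₃⟦n⟧)) (h₂ : HomVanish W (D.obj₂⟦m⟧)) : HomVanish W (D.obj₁⟦m⟧) :=
  HomVanish.to_shift_obj₂ (inv_rot_of_distTriang _ hD)
    ((homVanish_shift_add_iff _ _ (-1) m n (by lia)).2 h₃) h₂

lemma HomVanish.from_obj₁ {W : T} {n m : ℤ} (h : n + 1 = m)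
    (h₂ : HomVanish D.obj₂ (W⟦n⟧)) (h₃ : HomVanish D.obj₃ (W⟦m⟧)) : HomVanish D.obj₁ (W⟦n⟧) :=
  HomVanish.from_obj₂ (inv_rot_of_distTriang _ hD)
    ((homVanish_shift_iff _ _ (-1) n m (by lia)).2 h₃) h₂

lemma HomVanish.from_obj₃ {W : T} {n m : ℤ} (h : n + 1 = m)
    (h₁ : HomVanish D.obj₁ (W⟦n⟧)) (h₂ : HomVanish D.obj₂ (W⟦m⟧)) : HomVanish D.obj₃ (W⟦m⟧) :=
  HomVanish.from_obj₂ (rot_of_distTriang _ hD) h₂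
    ((homVanish_shift_iff _ _ 1 m n (by lia)).2 h₁)

end Triangles

end Shift

end HomVanish

/-! ### Complements on t-structures -/

section TStructure

variable {T : Type u} [Category.{v} T] [Preadditive T] [HasZeroObject T] [HasShift T ℤ]
  [∀ n : ℤ, (shiftFunctor T n).Additive] [Pretriangulated T]
  (t : TStructure T)

lemma homVanish_of_le_of_ge {X Y : T} (a b : ℤ) (h : a < b) (hX : t.le a X) (hY : t.ge b Y) :
    HomVanish X Y := fun f ↦ t.zero_of_isLE_of_isGE f a b h ⟨hX⟩ ⟨hY⟩

lemma le_iff_homVanish (a b : ℤ) (h : a + 1 = b) (X : T) :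
    t.le a X ↔ ∀ Y, t.ge b Y → HomVanish X Y := by
  rw [t.le_iff_isLE, t.isLE_iff_orthogonal a b h]
  exact ⟨fun H Y hY f ↦ H Y f ⟨hY⟩, fun H Y f hY ↦ H Y hY.ge f⟩

lemma ge_iff_homVanish (a b : ℤ) (h : a + 1 = b) (Y : T) :
    t.ge b Y ↔ ∀ X, t.le a X → HomVanish X Y := by
  rw [t.ge_iff_isGE, t.isGE_iff_orthogonal a b h]
  exact ⟨fun H X hX f ↦ H X f ⟨hX⟩, fun H X f hX ↦ H X hX.le f⟩

lemma le_of_retract {a : ℤ} {X Y : T} (r : Retract X Y) (h : t.le a Y) : t.le a X := by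
  rw [le_iff_homVanish t a _ rfl] at h ⊢
  exact fun Z hZ ↦ (h Z hZ).of_retract_left r

lemma ge_of_retract {a : ℤ} {X Y : T} (r : Retract X Y) (h : t.ge a Y) : t.ge a X := by
  rw [ge_iff_homVanish t (a - 1) a (by lia)] at h ⊢
  exact fun Z hZ ↦ (h Z hZ).of_retract_right r

lemma le_of_isColimit {a : ℤ} {I : Type*} {F : I → T} (h : ∀ i, t.le a (F i))
    {c : Cofan F} (hc : IsColimit c) : t.le a c.pt := by
  rw [le_iff_homVanish t a _ rfl]
  exact fun Y hY ↦ HomVanish.of_isColimit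
    (fun i ↦ homVanish_of_le_of_ge t _ _ (lt_add_one a) (h i) hY) hc

lemma le_shift_iff (X : T) (n a n' : ℤ) (h : a + n' = n) : t.le n' (X⟦a⟧) ↔ t.le n X := by
  simpa using t.isLE_shift_iff X n a n' h

lemma ge_shift_iff (X : T) (n a n' : ℤ) (h : a + n' = n) : t.ge n' (X⟦a⟧) ↔ t.ge n X := by
  simpa using t.isGE_shift_iff X n a n' h

lemma le_obj₂ {D : Triangle T} (hD : D ∈ distTriang T) {n : ℤ} (h₁ : t.le n D.obj₁)
    (h₃ : t.le n D.obj₃) : t.le n D.obj₂ :=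
  (t.isLE₂ D hD n ⟨h₁⟩ ⟨h₃⟩).le

lemma ge_obj₂ {D : Triangle T} (hD : D ∈ distTriang T) {n : ℤ} (h₁ : t.ge n D.obj₁)
    (h₃ : t.ge n D.obj₃) : t.ge n D.obj₂ :=
  (t.isGE₂ D hD n ⟨h₁⟩ ⟨h₃⟩).ge

lemma ge_obj₁ {D : Triangle T} (hD : D ∈ distTriang T) {n m : ℤ} (h : n + 1 = m)
    (h₃ : t.ge n D.obj₃) (h₂ : t.ge m D.obj₂) : t.ge m D.obj₁ :=
  ge_obj₂ t (inv_rot_of_distTriang _ hD) (t.ge_shift n (-1) m (by lia) _ h₃) h₂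

lemma le_obj₁ {D : Triangle T} (hD : D ∈ distTriang T) {n m : ℤ} (h : n + 1 = m)
    (h₃ : t.le n D.obj₃) (h₂ : t.le m D.obj₂) : t.le m D.obj₁ :=
  le_obj₂ t (inv_rot_of_distTriang _ hD) (t.le_shift n (-1) m (by lia) _ h₃) h₂

lemma ge_obj₃ {D : Triangle T} (hD : D ∈ distTriang T) {n m : ℤ} (h : n + 1 = m)
    (h₂ : t.ge n D.obj₂) (h₁ : t.ge m D.obj₁) : t.ge n D.obj₃ :=
  ge_obj₂ t (rot_of_distTriang _ hD) h₂ (t.ge_shift m 1 n (by lia) _ h₁)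

lemma heart_shift {X : T} (n : ℤ) (h₁ : t.le n X) (h₂ : t.ge n X) : t.heart (X⟦n⟧) :=
  ⟨t.le_shift n n 0 (add_zero n) _ h₁, t.ge_shift n n 0 (add_zero n) _ h₂⟩

lemma bounded_iff (X : T) : t.bounded X ↔ (∃ a, t.ge a X) ∧ ∃ b, t.le b X :=
  ⟨fun h ↦ ⟨h.1.imp fun _ h ↦ h.ge, h.2.imp fun _ h ↦ h.le⟩,
    fun h ↦ ⟨h.1.imp fun _ h ↦ ⟨h⟩, h.2.imp fun _ h ↦ ⟨h⟩⟩⟩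

lemma heart_le_bounded : t.heart ≤ t.bounded := fun X h ↦
  (bounded_iff t X).2 ⟨⟨0, h.2⟩, ⟨0, h.1⟩⟩

instance : t.bounded.IsStableUnderRetracts where
  of_retract r h := by
    rw [bounded_iff] at h ⊢
    exact ⟨h.1.imp fun _ ↦ ge_of_retract t r, h.2.imp fun _ ↦ le_of_retract t r⟩

/-- An object in degrees `[a, b]` is an iterated extension of objects concentrated in a single
degree in `[a, b]`. -/
lemma induction_of_le_of_ge [IsTriangulated T] (Q : ObjectProperty T)
    (hQ₀ : ∀ X, IsZero X → Q X)
    (hQ₂ : ∀ D ∈ distTriang T, Q D.obj₁ → Q D.obj₃ → Q D.obj₂) (a b : ℤ)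
    (h : ∀ n, a ≤ n → n ≤ b → ∀ X, t.le n X → t.ge n X → Q X)
    (X : T) (hX₁ : t.ge a X) (hX₂ : t.le b X) : Q X := by
  obtain hab | hab := lt_or_ge b a
  · exact hQ₀ _ (homVanish_of_le_of_ge t b a hab hX₂ hX₁).isZero
  · obtain ⟨k, rfl⟩ := Int.le.dest hab
    clear hab
    induction k generalizing X with
    | zero => exact h a le_rfl (by lia) X (by simpa using hX₂) hX₁
    | succ k hk =>
      have hX₁' : t.IsGE X a := ⟨hX₁⟩
      have hX₂' : t.IsLE X (a + (k + 1 : ℕ)) := ⟨hX₂⟩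
      refine hQ₂ _ (t.triangleLTGE_distinguished (a + (k + 1 : ℕ)) X) ?_ ?_
      · refine hk _ ?_ (fun n hn hn' ↦ h n hn (by lia)) ?_
        · exact (inferInstance : t.IsGE ((t.truncLT (a + (k + 1 : ℕ))).obj X) a).ge
        · exact (t.isLE_truncLT_obj X (a + (k + 1 : ℕ)) (a + k) (by lia)).le
      · refine h (a + (k + 1 : ℕ)) (by lia) le_rfl _ ?_ ?_
        · exact (inferInstance : t.IsLE ((t.truncGE (a + (k + 1 : ℕ))).obj X) _).le
        · exact (inferInstance : t.IsGE ((t.truncGE (a + (k + 1 : ℕ))).obj X) _).ge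

/-- Morphisms of degree `n` between objects of the heart of `t` vanish. -/
def HeartVanish (n : ℤ) : Prop :=
  ∀ X Y, t.heart X → t.heart Y → HomVanish X (Y⟦n⟧)

variable {t} in
/-- If morphisms of degree `≥ d` between objects of the heart vanish, then so do morphisms from
objects in high degrees to objects in low degrees. -/
lemma HeartVanish.homVanish [IsTriangulated T] {d : ℤ} (h : ∀ m, d ≤ m → HeartVanish t m)
    {a b a' b' : ℤ} (hd : b' + d ≤ a) {X Y : T} (hX₁ : t.ge a X) (hX₂ : t.le b X) (hY₁ : t.ge a' Y)
    (hY₂ : t.le b' Y) : HomVanish X Y := by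
  refine induction_of_le_of_ge t (fun X ↦ HomVanish X Y) (fun _ ↦ homVanish_of_isZero_left)
    (fun D hD ↦ HomVanish.from_obj₂ hD) a b (fun n hn _ X hX₁ hX₂ ↦ ?_) X hX₁ hX₂
  refine induction_of_le_of_ge t (fun Y ↦ HomVanish X Y) (fun _ ↦ homVanish_of_isZero_right)
    (fun D hD ↦ HomVanish.to_obj₂ hD) a' b' (fun n' _ hn' Y hY₁ hY₂ ↦ ?_) Y hY₁ hY₂
  rw [← homVanish_shift_shift_iff _ _ n]
  -- Moving both objects into the heart turns the morphisms into degree n - n', and n - n' ≥ a - b'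
  -- ≥ d.
  have := h (n - n') (by lia) _ _ (heart_shift t n hX₁ hX₂) (heart_shift t n' hY₁ hY₂)
  rwa [homVanish_shift_add_iff _ _ n' (n - n') n (by lia)] at this

end TStructure

/-! ### Global dimension of hearts with the same bounded objects -/

section Thick

variable {T : Type u} [Category.{v} T] [Preadditive T] [HasZeroObject T] [HasShift T ℤ]
  [∀ n : ℤ, (shiftFunctor T n).Additive] [Pretriangulated T] (P : ObjectProperty T)

lemma le_thick : P ≤ thick P := fun _ h _ _ _ hQ ↦ hQ _ h

variable {P} in
lemma thick_le {Q : ObjectProperty T} [Q.IsTriangulated] [Q.IsStableUnderRetracts]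
    (h : P ≤ Q) : thick P ≤ Q := fun _ hX ↦ hX Q inferInstance inferInstance h

instance : (thick P).IsStableUnderRetracts where
  of_retract r h Q hQ hQ' hP := Q.prop_of_retract r (h Q hQ hQ' hP)

instance : (thick P).IsClosedUnderIsomorphisms where
  of_iso e h := (thick P).prop_of_retract (Retract.ofIso e.symm) h

instance : (thick P).IsTriangulated where
  exists_zero := ⟨0, isZero_zero T, fun Q hQ hQ' _ ↦ by
    obtain ⟨X, hX, h⟩ := Q.exists_prop_of_containsZero
    exact Q.prop_of_retract ⟨0, 0, (isZero_zero T).eq_of_src _ _⟩ h⟩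
  isStableUnderShiftBy n := ⟨fun X h Q hQ hQ' hP ↦ Q.le_shift n _ (h Q hQ hQ' hP)⟩
  toIsTriangulatedClosed₂ := .mk' fun D hD h₁ h₃ Q hQ hQ' hP ↦ by
    -- `Q` is not assumed closed under isomorphisms, so the extension is only isomorphic to an
    -- object of `Q`; stability under retracts repairs this.
    obtain ⟨Y, hY, ⟨e⟩⟩ := Q.ext_of_isTriangulatedClosed₂' D hD (h₁ Q hQ hQ' hP) (h₃ Q hQ hQ' hP)
    exact Q.prop_of_retract (Retract.ofIso e) hY

end Thick

/-! ### Tilting t-structures: resolutions by Add(M), comparison of hearts, thick generation. -/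

section Silting

variable {T : Type u} [Category.{v} T] [Preadditive T] [HasZeroObject T] [HasShift T ℤ]
  [∀ n : ℤ, (shiftFunctor T n).Additive] [Pretriangulated T] [IsTriangulated T]
  {M : T} {t : TStructure T}

lemma add_of_retract {X Y : T} (r : Retract X Y) (h : add M Y) : add M X := by
  obtain ⟨I, c, hc, ⟨r'⟩⟩ := h
  exact ⟨I, c, hc, ⟨r.trans r'⟩⟩

lemma add_pt {I : Type v} {c : Cofan (fun _ : I ↦ M)} (hc : IsColimit c) : add M c.pt :=
  ⟨I, c, ⟨hc⟩, ⟨Retract.refl _⟩⟩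

variable (M) in
lemma add_self : add M M :=
  add_pt (I := PUnit.{v + 1}) (c := Cofan.mk M fun _ ↦ 𝟙 M)
    (Cofan.IsColimit.mk _ (fun s ↦ s.inj ⟨⟩) (by simp) (fun s m h ↦ by simpa using h ⟨⟩))

lemma homVanish_of_add {X Y : T} (hX : add M X) (h : HomVanish M Y) : HomVanish X Y := by
  obtain ⟨I, c, ⟨hc⟩, ⟨r⟩⟩ := hX
  exact (HomVanish.of_isColimit (fun _ ↦ h) hc).of_retract_left r

/-- A coproduct of copies of `M` is a retract of any coproduct of at least as many copies. -/
def retractOfInjective {I J : Type*} (φ : I → J) (hφ : Function.Injective φ)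
    {c : Cofan (fun _ : I ↦ M)} (hc : IsColimit c) {c' : Cofan (fun _ : J ↦ M)}
    (hc' : IsColimit c') : Retract c.pt c'.pt where
  i := Cofan.IsColimit.desc hc fun i ↦ c'.inj (φ i)
  -- Copies outside the image of `φ` go to zero; injectivity makes the chosen preimage of `φ i`
  -- equal to `i`.
  r := Cofan.IsColimit.desc hc' fun j ↦ by
    classical exact if h : ∃ i, φ i = j then c.inj h.choose else 0
  retract := Cofan.IsColimit.hom_ext hc _ _ fun i ↦ by
    have h : ∃ i', φ i' = φ i := ⟨i, rfl⟩
    have h' : h.choose = i := hφ h.choose_spec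
    simp [h']

lemma add_le_heart (ht : IsSiltingTStructure M t) (hadd : add M ≤ rightPerp M {0}ᶜ) :
    add M ≤ t.heart := fun X hX ↦ by
  have h := hadd X hX
  refine ⟨?_, ?_⟩
  · rw [ht.1]
    exact fun i hi ↦ h i (ne_of_gt hi)
  · rw [ht.2]
    exact fun i hi ↦ h i (ne_of_lt hi)

/-- Projectivity of Add(M) in the strong, triangulated sense: it kills all positive degrees at once.
Morphisms out of a coproduct are determined by their components, so the definition of the aisle by M
suffices. -/
lemma homVanish_of_add_of_le (ht : IsSiltingTStructure M t) {X Y : T} (hX : add M X)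
    (hY : t.le 0 Y) {n : ℤ} (hn : 0 < n) : HomVanish X (Y⟦n⟧) := by
  rw [ht.1] at hY
  exact homVanish_of_add hX (hY n hn)

variable [HasCoproducts.{v} T]

/-- Every object of the heart of a tilting t-structure is a quotient of a coproduct of
copies of the tilting object. -/
lemma exists_triangle_of_heart (ht : IsSiltingTStructure M t)
    (hadd : add M ≤ rightPerp M {0}ᶜ) {X : T} (hX : t.heart X) :
    ∃ D ∈ distTriang T, t.heart D.obj₁ ∧ add M D.obj₂ ∧ D.obj₃ = X := by
  -- The coproduct is indexed by all morphisms M ⟶ X, so each of them factors through `p`.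
  let p : (∐ fun _ : M ⟶ X ↦ M) ⟶ X := Sigma.desc fun f ↦ f
  have hM : add M (∐ fun _ : M ⟶ X ↦ M) := add_pt (coproductIsCoproduct _)
  obtain ⟨K, f, g, hD⟩ := distinguished_cocone_triangle₁ p
  have hM' := add_le_heart ht hadd _ hM
  have hK : t.le 1 K := le_obj₁ t hD (zero_add 1) hX.1 (t.le_monotone zero_le_one _ hM'.1)
  refine ⟨_, hD, ⟨?_, ?_⟩, hM, rfl⟩
  · rw [ht.1]
    intro i hi
    -- Only degree 1 needs the choice of `p`: a map M ⟶ K[1] dies in the shifted coproduct, hence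
    -- comes from M ⟶ X, which factors through `p`, and `p ≫ g = 0`. Higher degrees follow from K
    -- being in `t.le 1`.
    obtain rfl | hi := (show (1 : ℤ) ≤ i from hi).eq_or_lt
    · intro a
      obtain ⟨b, rfl⟩ := Triangle.coyoneda_exact₁ _ hD a
        (homVanish_of_add_of_le ht (add_self M) hM'.1 zero_lt_one _)
      have hb : b = Sigma.ι (fun _ : M ⟶ X ↦ M) b ≫ p := by simp [p]
      have : p ≫ g = 0 := comp_distTriang_mor_zero₂₃ _ hD
      exact (congrArg (· ≫ g) hb).trans ((Category.assoc _ _ _).trans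
        ((congrArg (_ ≫ ·) this).trans comp_zero))
    · have := homVanish_of_add_of_le ht (add_self M) ((le_shift_iff t K 1 1 0 rfl).2 hK)
        (show 0 < i - 1 by lia)
      exact (homVanish_shift_add_iff M K 1 (i - 1) i (by lia)).1 this
  · exact ge_obj₁ t hD (neg_add_cancel 1) (t.ge_antitone (by lia) _ hX.2) hM'.2

/-- Dimension shifting along the cover by Add(M): the syzygy is again in the heart, and the middle
term has no morphisms of positive degree to it. A general t-structure offers no such passage from
one degree to the next. -/
lemma HeartVanish.succ (ht : IsSiltingTStructure M t) (hadd : add M ≤ rightPerp M {0}ᶜ)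
    {n m : ℤ} (hn : 0 ≤ n) (hm : n + 1 = m) (h : HeartVanish t n) : HeartVanish t m := by
  intro X Y hX hY
  obtain ⟨D, hD, h₁, h₂, rfl⟩ := exists_triangle_of_heart ht hadd hX
  exact HomVanish.from_obj₃ hD hm (h _ _ h₁ hY) (homVanish_of_add_of_le ht h₂ hY.1 (by lia))

lemma HeartVanish.of_le (ht : IsSiltingTStructure M t) (hadd : add M ≤ rightPerp M {0}ᶜ)
    {n m : ℤ} (hn : 0 ≤ n) (hm : n ≤ m) (h : HeartVanish t n) : HeartVanish t m := by
  induction m, hm using Int.leInduction with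
  | base => exact h
  | succ m hm h => exact h.succ ht hadd (hn.trans hm) rfl

/-- Induction on the length of a resolution by summands of coproducts of copies of `M`. -/
lemma resolution_induction (ht : IsSiltingTStructure M t) (hadd : add M ≤ rightPerp M {0}ᶜ)
    (Q : ℕ → ObjectProperty T) (hQ₀ : add M ≤ Q 0)
    (hQ : ∀ n, ∀ D ∈ distTriang T, Q n D.obj₁ → add M D.obj₂ → Q (n + 1) D.obj₃)
    (n : ℕ) (X : T) (hX : t.heart X) (h : ∀ Y, t.heart Y → HomVanish X (Y⟦(n + 1 : ℤ)⟧)) :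
    Q n X := by
  induction n generalizing X with
  | zero =>
    obtain ⟨D, hD, h₁, h₂, rfl⟩ := exists_triangle_of_heart ht hadd hX
    refine hQ₀ _ (add_of_retract ?_ h₂)
    have h₀ : HomVanish D.obj₃ (D.obj₁⟦(1 : ℤ)⟧) := by simpa using h _ h₁
    -- The connecting morphism is zero, so the triangle splits and the object is a summand of its
    -- cover.
    have := Triangle.coyoneda_exact₃ _ hD (𝟙 _) (h₀ _)
    exact ⟨this.choose, D.mor₂, this.choose_spec.symm⟩
  | succ n hn =>
    obtain ⟨D, hD, h₁, h₂, rfl⟩ := exists_triangle_of_heart ht hadd hX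
    refine hQ _ _ hD (hn _ h₁ fun Y hY ↦ ?_) h₂
    exact HomVanish.from_obj₁ hD rfl (homVanish_of_add_of_le ht h₂ hY.1 (by lia))
      (by simpa using h Y hY)

/-- If all coproducts of copies of `M` are bounded, then they are uniformly bounded. -/
lemma exists_add_le_of_add_le_bounded (h : add M ≤ t.bounded) :
    ∃ a b, ∀ X, add M X → t.ge a X ∧ t.le b X := by
  obtain ⟨⟨a₀, -⟩, ⟨b, hb⟩⟩ := (bounded_iff t M).1 (h _ (add_self M))
  have hb' : ∀ X, add M X → t.le b X := by
    rintro X ⟨I, c, ⟨hc⟩, ⟨r⟩⟩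
    exact le_of_retract t r (le_of_isColimit t (fun _ ↦ hb) hc)
  -- The upper bound is inherited from M, aisles being closed under coproducts and summands. Only
  -- the lower bound can fail to be uniform.
  by_contra! H
  have H' : ∀ k : ℕ, ∃ I : Type v, ¬ t.ge (-k) (∐ fun _ : I ↦ M) := fun k ↦ by
    obtain ⟨X, hX, hX'⟩ := H (-k) b
    have hX'' : ¬ t.ge (-k) X := fun h ↦ hX' h (hb' X hX)
    obtain ⟨I, c, ⟨hc⟩, ⟨r⟩⟩ := hX
    refine ⟨I, fun h ↦ hX'' (ge_of_retract t (r.trans ?_) h)⟩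
    exact Retract.ofIso (hc.coconePointUniqueUpToIso (coproductIsCoproduct _))
  choose I hI using H'
  -- The coproduct over all the offending index sets is bounded below by some `a`, and contains each
  -- offending coproduct as a summand.
  obtain ⟨⟨a, ha⟩, -⟩ := (bounded_iff t _).1
    (h _ (add_pt (coproductIsCoproduct (fun _ : (Σ k, I k) ↦ M))))
  refine hI (-a).toNat (t.ge_antitone (show -((-a).toNat : ℤ) ≤ a by lia) _
    (ge_of_retract t ?_ ha))
  exact retractOfInjective (Sigma.mk _) sigma_mk_injective (coproductIsCoproduct _)
    (coproductIsCoproduct _)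

/-- If the heart of a tilting t-structure `t` has finite global dimension, then the vanishing of
morphisms of large degree also holds in the heart of any t-structure `t'` with the same bounded
objects. -/
theorem exists_heartVanish_of_heartVanish (ht : IsSiltingTStructure M t)
    (hadd : add M ≤ rightPerp M {0}ᶜ) (t' : TStructure T) (htt' : t.bounded = t'.bounded)
    (h : ∃ n : ℕ, 0 < n ∧ HeartVanish t n) : ∃ n : ℕ, 0 < n ∧ HeartVanish t' n := by
  obtain ⟨d, hd, h⟩ := h
  obtain ⟨d, rfl⟩ : ∃ d', d = d' + 1 := ⟨d - 1, by lia⟩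
  obtain ⟨a, b, hab⟩ := exists_add_le_of_add_le_bounded (M := M) (t := t')
    (htt' ▸ (add_le_heart ht hadd).trans (heart_le_bounded t))
  -- Each step of the resolution costs one degree, starting from the bound `a` for Add(M).
  have h₁ : ∀ X, t.heart X → t'.ge (a - d) X := fun X hX ↦ by
    refine resolution_induction ht hadd (fun n ↦ t'.ge (a - n)) ?_ ?_ d X hX
      fun Y hY ↦ by simpa using h X Y hX hY
    · intro Y hY
      simpa using (hab Y hY).1
    · intro n D hD h₁ h₂
      exact ge_obj₃ t' hD (by push_cast; lia)
        (t'.ge_antitone (show a - (n + 1 : ℕ) ≤ a by lia) _ (hab _ h₂).1) h₁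
  have h₂ : ∀ X m n, t.ge m X → t.le n X → t'.ge (m + a - d) X := fun X m n hm hn ↦ by
    refine induction_of_le_of_ge t (t'.ge (m + a - d)) (fun X hX ↦ (t'.isGE_of_isZero hX _).ge)
      (fun D hD ↦ ge_obj₂ t' hD) m n (fun k hk _ X hX₁ hX₂ ↦ ?_) X hm hn
    exact t'.ge_antitone (show m + a - d ≤ k + a - d by lia) _
      ((ge_shift_iff t' X _ k (a - d) (by lia)).1 (h₁ _ (heart_shift t k hX₁ hX₂)))
  -- M is in `t'.le b`, so it has no morphism to Y[i - b] for i < 0, which is the description of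
  -- `t.ge` by M.
  have h₃ : ∀ Y, t'.heart Y → t.ge (-b) Y := fun Y hY ↦ by
    rw [← ge_shift_iff t Y (-b) (-b) 0 (by lia), ht.2]
    intro i hi
    refine (homVanish_shift_add_iff M Y (-b) i (i - b) (by lia)).2 ?_
    exact homVanish_of_le_of_ge t' b (b - i) (by have : i < 0 := hi; lia) (hab _ (add_self M)).2
      (t'.ge_shift 0 (i - b) (b - i) (by lia) _ hY.2)
  -- The truncation of Y in t-degrees at least d - a + 1 lies in `t'.ge 1` by `h₂`, whose range
  -- hypothesis is met because Y is bounded. Hence Y maps to it by zero, and the truncation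
  -- vanishes.
  have h₄ : ∀ Y, t'.heart Y → t.le (d - a) Y := fun Y hY ↦ by
    have hY' : t.bounded Y := htt' ▸ heart_le_bounded t' _ hY
    obtain ⟨-, ⟨q, hq⟩⟩ := (bounded_iff t Y).1 hY'
    have hq' : t.IsLE Y q := ⟨hq⟩
    rw [t.le_iff_isLE, t.isLE_iff_isZero_truncGE_obj _ _ rfl, IsZero.iff_id_eq_zero]
    have h₅ : t'.ge 1 ((t.truncGE (d - a + 1)).obj Y) :=
      t'.ge_antitone (by lia) _ (h₂ _ (d - a + 1) q
        (inferInstance : t.IsGE ((t.truncGE (d - a + 1)).obj Y) _).ge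
        (inferInstance : t.IsLE ((t.truncGE (d - a + 1)).obj Y) q).le)
    exact t.from_truncGE_obj_ext (homVanish_of_le_of_ge t' 0 1 zero_lt_one hY.1 h₅ _ |>.trans
      (homVanish_of_le_of_ge t' 0 1 zero_lt_one hY.1 h₅ _).symm)
  -- With both objects in t-degrees [-b, d - a], vanishing after a shift by e requires (d - a - e) +
  -- (d + 1) ≤ -b.
  refine ⟨(2 * d + 1 - a + b).toNat + 1, by lia, fun X Y hX hY ↦ ?_⟩
  generalize he : (((2 * d + 1 - a + b).toNat + 1 : ℕ) : ℤ) = e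
  exact HeartVanish.homVanish (t := t) (d := (d + 1 : ℕ))
    (fun m hm ↦ HeartVanish.of_le ht hadd (by lia) hm h) (b' := d - a - e) (by lia)
    (h₃ X hX) (h₄ X hX) (t.ge_shift _ e (-b - e) (by lia) _ (h₃ Y hY))
    (t.le_shift _ e (d - a - e) (by lia) _ (h₄ Y hY))

/-- If the heart of a tilting t-structure has finite global dimension, then all bounded objects are
generated by the coproducts of copies of the tilting object. -/
lemma bounded_le_thick (ht : IsSiltingTStructure M t) (hadd : add M ≤ rightPerp M {0}ᶜ)
    (h : ∃ n : ℕ, 0 < n ∧ HeartVanish t n) : t.bounded ≤ thick (add M) := by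
  obtain ⟨d, hd, h⟩ := h
  obtain ⟨d, rfl⟩ : ∃ d', d = d' + 1 := ⟨d - 1, by lia⟩
  have h₁ : t.heart ≤ thick (add M) := fun X hX ↦
    resolution_induction ht hadd (fun _ ↦ thick (add M)) (le_thick _)
      (fun n D hD h₁ h₂ ↦ (thick (add M)).ext_of_isTriangulatedClosed₃ D hD h₁ (le_thick _ _ h₂))
      d X hX fun Y hY ↦ by simpa using h X Y hX hY
  intro X hX
  obtain ⟨⟨a, ha⟩, ⟨b, hb⟩⟩ := (bounded_iff t X).1 hX
  refine induction_of_le_of_ge t (thick (add M)) (fun X hX ↦ ?_) (fun D hD ↦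
    (thick (add M)).ext_of_isTriangulatedClosed₂ D hD) a b (fun n _ _ X hX₁ hX₂ ↦ ?_) X ha hb
  · obtain ⟨Y, hY, h⟩ := (thick (add M)).exists_prop_of_containsZero
    exact (thick (add M)).prop_of_iso (hY.iso hX) h
  · exact (thick (add M)).prop_of_iso ((shiftEquiv T n).unitIso.symm.app X)
      ((thick (add M)).le_shift (-n) _ (h₁ _ (heart_shift t n hX₁ hX₂)))

/-- If the coproducts of copies of the tilting object generate the heart, then the heart has finite
global dimension. -/
lemma exists_heartVanish_of_heart_le_thick (ht : IsSiltingTStructure M t)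
    (h : t.heart ≤ thick (add M)) : ∃ n : ℕ, 0 < n ∧ HeartVanish t n := by
  -- The objects of finite projective dimension relative to the heart; the bound may depend on the
  -- object. They form a thick subcategory containing Add(M).
  let Q : ObjectProperty T := fun X ↦
    ∃ n : ℤ, ∀ m, n ≤ m → ∀ Y, t.heart Y → HomVanish X (Y⟦m⟧)
  have : Q.IsStableUnderRetracts := ⟨fun r ⟨n, h⟩ ↦
    ⟨n, fun m hm Y hY ↦ (h m hm Y hY).of_retract_left r⟩⟩
  have : Q.IsClosedUnderIsomorphisms := ⟨fun e ↦ Q.prop_of_retract (Retract.ofIso e.symm)⟩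
  have : Q.IsTriangulated :=
    { exists_zero := ⟨0, isZero_zero T, 0, fun _ _ _ _ ↦ homVanish_of_isZero_left (isZero_zero T)⟩
      isStableUnderShiftBy := fun a ↦ ⟨fun X ⟨n, h⟩ ↦ ⟨n + a, fun m hm Y hY ↦
        (homVanish_shift_iff X Y a m (m - a) (by lia)).2 (h _ (by lia) Y hY)⟩⟩
      toIsTriangulatedClosed₂ := .mk' fun D hD ⟨n₁, h₁⟩ ⟨n₃, h₃⟩ ↦ ⟨max n₁ n₃, fun m hm Y hY ↦
        HomVanish.from_obj₂ hD (h₁ m (by lia) Y hY) (h₃ m (by lia) Y hY)⟩ }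
  have hQ : t.heart ≤ Q := h.trans (thick_le fun X hX ↦
    ⟨1, fun m hm Y hY ↦ homVanish_of_add_of_le ht hX hY.1 (by lia)⟩)
  by_contra! H
  simp only [HeartVanish, not_forall] at H
  choose X Y hX hY hXY using fun k : ℕ ↦ H (k + 1) (by lia)
  -- Collect counterexamples of unbounded degree in one object. The coproduct lies only in `t.le 0`,
  -- so its truncation is the object of the heart to be tested.
  let C : T := ∐ fun k : ULift.{v} ℕ ↦ X k.down
  have hC : t.IsLE C 0 := ⟨le_of_isColimit t (F := fun k : ULift.{v} ℕ ↦ X k.down)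
    (fun k ↦ (hX k.down).1) (coproductIsCoproduct _)⟩
  obtain ⟨n, hn⟩ := hQ ((t.truncGE 0).obj C)
    ⟨(inferInstance : t.IsLE ((t.truncGE 0).obj C) 0).le,
      (inferInstance : t.IsGE ((t.truncGE 0).obj C) 0).ge⟩
  have hX' : t.IsGE (X n.toNat) 0 := ⟨(hX n.toNat).2⟩
  -- The projection of `C` to a term factors through the truncation because the term is in `t.ge 0`;
  -- so each term remains a summand after truncating.
  refine hXY n.toNat ((hn _ (by lia) _ (hY _)).of_retract_left
    ⟨Sigma.ι (fun k : ULift.{v} ℕ ↦ X k.down) ⟨n.toNat⟩ ≫ (t.truncGEπ 0).app C,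
      t.descTruncGE (Sigma.π (fun k : ULift.{v} ℕ ↦ X k.down) ⟨n.toNat⟩) 0, ?_⟩)
  rw [Category.assoc, t.π_descTruncGE]
  exact Sigma.ι_π_eq_id _ _

end Silting

/-! ### A criterion for t-structures to be tilting -/

section Criterion

variable {T : Type u} [Category.{v} T] [Preadditive T] [HasZeroObject T] [HasShift T ℤ]
  [∀ n : ℤ, (shiftFunctor T n).Additive] [Pretriangulated T] [IsTriangulated T]

/-- The condition that `M` behaves as a projective generator of the heart of the t-structure `t`,
and that `t` is nondegenerate. -/
structure IsProjGenerator (M : T) (t : TStructure T) : Prop where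
  le : t.le 0 M
  homVanish : ∀ X, t.le (-1) X → HomVanish M X
  isZero : ∀ X, t.heart X → HomVanish M X → IsZero X
  isZero_of_ge : ∀ X, (∀ n, t.ge n X) → IsZero X
  isZero_of_le : ∀ X, (∀ n, t.le n X) → IsZero X

variable {M : T} {t : TStructure T}

namespace IsProjGenerator

variable (h : IsProjGenerator M t)
include h

lemma homVanish_shift {X : T} {a n : ℤ} (hX : t.le a X) (hn : a < n) : HomVanish M (X⟦n⟧) :=
  h.homVanish _ (t.le_monotone (show a - n ≤ -1 by lia) _ (t.le_shift a n (a - n) (by lia) _ hX))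

lemma homVanish_shift_of_ge {X : T} {a n : ℤ} (hX : t.ge a X) (hn : n < a) :
    HomVanish M (X⟦n⟧) :=
  homVanish_of_le_of_ge t 0 (a - n) (by lia) h.le (t.ge_shift a n (a - n) (by lia) _ hX)

lemma isZero_of_homVanish {X : T} {n : ℤ} (h₁ : t.le n X) (h₂ : t.ge n X)
    (hX : HomVanish M (X⟦n⟧)) : IsZero X :=
  (h.isZero _ (heart_shift t n h₁ h₂) hX).of_full_of_faithful_of_isZero (shiftFunctor T n) X

/-- Climb one degree at a time: the lowest cohomology of X receives from M only what X does, hence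
nothing, and so vanishes. X then lies in every `t.ge n` and nondegeneracy concludes. The next lemma
descends in the same way from the top cohomology. -/
lemma isZero_of_ge_of_homVanish {X : T} (a : ℤ) (ha : t.ge a X)
    (hX : ∀ n : ℤ, HomVanish M (X⟦n⟧)) : IsZero X := by
  refine h.isZero_of_ge X fun n ↦ ?_
  obtain hn | hn := le_total n a
  · exact t.ge_antitone hn _ ha
  induction n, hn using Int.leInduction with
  | base => exact ha
  | succ n _ hn =>
    have : t.IsGE X n := ⟨hn⟩
    rw [t.ge_iff_isGE, t.isGE_iff_isZero_truncLT_obj]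
    refine h.isZero_of_homVanish (n := n) (t.isLE_truncLT_obj X (n + 1) n (by lia)).le
      (inferInstance : t.IsGE ((t.truncLT (n + 1)).obj X) n).ge ?_
    refine HomVanish.to_shift_obj₁ (t.triangleLTGE_distinguished (n + 1) X)
      (sub_add_cancel n 1) ?_ (hX n)
    exact h.homVanish_shift_of_ge (inferInstance : t.IsGE ((t.truncGE (n + 1)).obj X) (n + 1)).ge
      (by lia)

lemma isZero_of_le_of_homVanish {X : T} (a : ℤ) (ha : t.le a X)
    (hX : ∀ n : ℤ, HomVanish M (X⟦n⟧)) : IsZero X := by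
  refine h.isZero_of_le X fun n ↦ ?_
  obtain hn | hn := le_total a n
  · exact t.le_monotone hn _ ha
  induction n, hn using Int.leInductionDown with
  | base => exact ha
  | pred n _ hn =>
    have : t.IsLE X n := ⟨hn⟩
    rw [t.le_iff_isLE, t.isLE_iff_isZero_truncGE_obj (n - 1) n (by lia)]
    refine h.isZero_of_homVanish (n := n)
      (inferInstance : t.IsLE ((t.truncGE n).obj X) n).le
      (inferInstance : t.IsGE ((t.truncGE n).obj X) n).ge ?_
    refine HomVanish.to_shift_obj₃ (t.triangleLTGE_distinguished n X) rfl (hX n) ?_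
    exact h.homVanish_shift (t.isLE_truncLT_obj X n (n - 1) (by lia)).le (by lia)

/-- Orthogonality to M in the prescribed degrees passes to the truncation that has to vanish, and
its other degrees are automatic; such a half-bounded object receiving nothing from M is zero. -/
theorem isSiltingTStructure : IsSiltingTStructure M t := by
  constructor
  · ext X
    refine ⟨fun hX i hi ↦ h.homVanish_shift hX hi, fun hX ↦ ?_⟩
    rw [t.le_iff_isLE, t.isLE_iff_isZero_truncGE_obj 0 1 rfl]
    have h₁ : t.ge 1 ((t.truncGE 1).obj X) :=
      (inferInstance : t.IsGE ((t.truncGE 1).obj X) 1).ge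
    refine h.isZero_of_ge_of_homVanish 1 h₁ fun n ↦ ?_
    obtain hn | hn := lt_or_ge n 1
    · exact h.homVanish_shift_of_ge h₁ hn
    · exact HomVanish.to_shift_obj₃ (t.triangleLTGE_distinguished 1 X) rfl (hX n hn)
        (h.homVanish_shift (t.isLE_truncLT_obj X 1 0 (by lia)).le (by lia))
  · ext X
    refine ⟨fun hX i hi ↦ h.homVanish_shift_of_ge hX hi, fun hX ↦ ?_⟩
    rw [t.ge_iff_isGE, t.isGE_iff_isZero_truncLT_obj]
    have h₁ : t.le (-1) ((t.truncLT 0).obj X) := (t.isLE_truncLT_obj X 0 (-1) (by lia)).le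
    refine h.isZero_of_le_of_homVanish (-1) h₁ fun n ↦ ?_
    obtain hn | hn := lt_or_ge (-1) n
    · exact h.homVanish_shift h₁ hn
    · exact HomVanish.to_shift_obj₁ (t.triangleLTGE_distinguished 0 X) (sub_add_cancel n 1)
        (h.homVanish_shift_of_ge (inferInstance : t.IsGE ((t.truncGE 0).obj X) 0).ge (by lia))
        (hX n (show n < 0 by lia))

/-- If objects `D` of the heart with `Ext¹(D, -) = 0` have no nonzero morphism to `t^{≤ -1}`, then
the coproducts of copies of `M` belong to the heart. -/
theorem add_le_rightPerp (hP : ∀ D, t.heart D → (∀ Y, t.heart Y → HomVanish D (Y⟦(1 : ℤ)⟧)) →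
    ∀ X, t.le (-1) X → HomVanish D X) : add M ≤ rightPerp M {0}ᶜ := by
  rintro X ⟨I, c, ⟨hc⟩, ⟨r⟩⟩
  have hle : t.le 0 c.pt := le_of_isColimit t (fun _ ↦ h.le) hc
  -- The degree 0 truncation of the coproduct has no Ext¹ to the heart, so by `hP` the truncation
  -- triangle splits. The complementary projection factors through `t.le (-1)`, where the coproduct
  -- of copies of M maps by zero; so the coproduct is a summand of its truncation.
  have hge : t.ge 0 c.pt := by
    have hle' : t.IsLE c.pt 0 := ⟨hle⟩
    have h₁ : t.le (-1) ((t.truncLT 0).obj c.pt) := (t.isLE_truncLT_obj _ 0 (-1) (by lia)).le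
    have h₂ : t.heart ((t.truncGE 0).obj c.pt) :=
      ⟨(inferInstance : t.IsLE ((t.truncGE 0).obj c.pt) 0).le,
        (inferInstance : t.IsGE ((t.truncGE 0).obj c.pt) 0).ge⟩
    have hD := t.triangleLTGE_distinguished 0 c.pt
    have h₃ := hP _ h₂ (fun Y hY ↦ HomVanish.from_obj₃ hD (zero_add 1)
        ((homVanish_shift_zero_iff _ _).2
          (homVanish_of_le_of_ge t (-1) 0 (by lia) h₁ hY.2))
        (HomVanish.of_isColimit (fun _ ↦ h.homVanish_shift hY.1 zero_lt_one) hc))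
      _ (t.le_monotone (show (-2 : ℤ) ≤ -1 by lia) _ (t.le_shift (-1) 1 (-2) (by lia) _ h₁))
    obtain ⟨s, hs⟩ := Triangle.coyoneda_exact₃ _ hD (𝟙 ((t.truncGE 0).obj c.pt)) (h₃ _)
    let p : c.pt ⟶ (t.truncGE 0).obj c.pt := (t.truncGEπ 0).app c.pt
    let s' : (t.truncGE 0).obj c.pt ⟶ c.pt := s
    have hs' : s' ≫ p = 𝟙 _ := hs.symm
    have hp : (𝟙 c.pt - p ≫ s') ≫ p = 0 := by
      rw [Preadditive.sub_comp, Category.assoc, hs', Category.id_comp, Category.comp_id, sub_self]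
    obtain ⟨g, hg⟩ := Triangle.coyoneda_exact₂ _ hD (𝟙 c.pt - p ≫ s') hp
    have hg₀ : g = 0 := HomVanish.of_isColimit (fun _ ↦ h.homVanish _ h₁) hc g
    have hg' : 𝟙 c.pt = p ≫ s' := sub_eq_zero.1 (hg.trans ((congrArg (· ≫ _) hg₀).trans zero_comp))
    exact ge_of_retract t ⟨p, s', hg'.symm⟩ h₂.2
  have hX₁ := le_of_retract t r hle
  have hX₂ := ge_of_retract t r hge
  intro i hi
  obtain hi | hi := lt_or_gt_of_ne (show i ≠ 0 from hi)
  · exact h.homVanish_shift_of_ge hX₂ hi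
  · exact h.homVanish_shift hX₁ hi

end IsProjGenerator

end Criterion

/-! ### The opposite t-structure -/

section Opposite

open CategoryTheory.Pretriangulated.Opposite Opposite

variable {T : Type u} [Category.{v} T] [Preadditive T]

lemma homVanish_iff_subsingleton (X Y : T) : HomVanish X Y ↔ Subsingleton (X ⟶ Y) :=
  ⟨fun h ↦ ⟨fun f g ↦ (h f).trans (h g).symm⟩, fun _ _ ↦ Subsingleton.elim _ _⟩

lemma homVanish_op_iff (X Y : Tᵒᵖ) : HomVanish X Y ↔ HomVanish Y.unop X.unop :=
  ⟨fun h f ↦ Quiver.Hom.op_inj (h f.op), fun h f ↦ Quiver.Hom.unop_inj (h f.unop)⟩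

variable [HasZeroObject T] [HasShift T ℤ]
  [∀ n : ℤ, (shiftFunctor T n).Additive] [Pretriangulated T]

/-- The shift by n on the opposite category is the shift by -n, and moving it to the other argument
restores the sign. Positive degrees therefore stay positive under duality. -/
lemma homVanish_op_shift_iff (X Y : Tᵒᵖ) (n : ℤ) :
    HomVanish X (Y⟦n⟧) ↔ HomVanish Y.unop (X.unop⟦n⟧) := by
  rw [homVanish_iff_subsingleton,
    ← (opShiftFunctorEquivalenceSymmHomEquiv (n := n) (X := X) (Y := Y)).subsingleton_congr,
    ← homVanish_iff_subsingleton, homVanish_op_iff]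

/-- The opposite t-structure. -/
def opTStructure (t : TStructure T) : TStructure Tᵒᵖ where
  le n := (t.ge (-n)).op
  ge n := (t.le (-n)).op
  le_shift n a n' h X hX := t.ge_shift (-n) (-a) (-n') (by lia) X.unop hX
  ge_shift n a n' h X hX := t.le_shift (-n) (-a) (-n') (by lia) X.unop hX
  zero' X Y f hX hY := Quiver.Hom.unop_inj
    (homVanish_of_le_of_ge t (-1) (-0) (by lia) hY hX f.unop)
  le_zero_le := fun X hX ↦ t.ge_antitone (by lia) X.unop hX
  ge_one_le := fun X hX ↦ t.le_monotone (by lia) X.unop hX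
  exists_triangle_zero_one A := by
    obtain ⟨X, Y, hX, hY, f, g, h, hD⟩ := t.exists_triangle A.unop (-1) (-0) (by lia)
    exact ⟨op Y, op X, hY, hX, _, _, _, op_distinguished _ hD⟩

variable (t : TStructure T)

lemma opTStructure_heart_iff (X : Tᵒᵖ) : (opTStructure t).heart X ↔ t.heart X.unop := and_comm

lemma opTStructure_bounded : (opTStructure t).bounded = t.bounded.op := by
  ext X
  rw [ObjectProperty.op_iff, bounded_iff, bounded_iff, and_comm]
  refine and_congr ⟨fun ⟨a, h⟩ ↦ ⟨-a, h⟩, fun ⟨a, h⟩ ↦ ⟨-a, ?_⟩⟩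
    ⟨fun ⟨a, h⟩ ↦ ⟨-a, h⟩, fun ⟨a, h⟩ ↦ ⟨-a, ?_⟩⟩
  · change t.ge (- -a) _
    rwa [neg_neg]
  · change t.le (- -a) _
    rwa [neg_neg]

lemma heartVanish_opTStructure_iff (n : ℤ) : HeartVanish (opTStructure t) n ↔ HeartVanish t n := by
  refine ⟨fun h X Y hX hY ↦ ?_, fun h X Y hX hY ↦ ?_⟩
  · exact (homVanish_op_shift_iff (op Y) (op X) n).1 (h _ _
      ((opTStructure_heart_iff t _).2 hY) ((opTStructure_heart_iff t _).2 hX))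
  · exact (homVanish_op_shift_iff X Y n).2 (h _ _
      ((opTStructure_heart_iff t _).1 hY) ((opTStructure_heart_iff t _).1 hX))

variable (M : T)

lemma rightPerp_op (I : Set ℤ) : rightPerp (op M) I = (leftPerp M I).op := by
  ext X
  exact forall₂_congr fun i _ ↦ homVanish_op_shift_iff (op M) X i

lemma add_op : add (op M) = (TiltingHearts.prod M).op := by
  ext X
  constructor
  · rintro ⟨I, c, ⟨hc⟩, ⟨r⟩⟩
    refine ⟨I, Fan.mk c.pt.unop fun i ↦ (c.inj i).unop, ⟨?_⟩, ⟨⟨r.r.unop, r.i.unop, ?_⟩⟩⟩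
    · refine Fan.IsLimit.mk _
        (fun s ↦ (Cofan.IsColimit.desc hc (fun i ↦ (s.proj i).op)).unop) (fun s i ↦ ?_)
        (fun s m h ↦ ?_)
      · exact Quiver.Hom.op_inj (Cofan.IsColimit.fac hc _ i)
      · refine Quiver.Hom.op_inj (Cofan.IsColimit.hom_ext hc _ _ fun i ↦ ?_)
        exact (congrArg Quiver.Hom.op (h i)).trans
          (Cofan.IsColimit.fac hc (fun i ↦ (s.proj i).op) i).symm
    · exact Quiver.Hom.op_inj r.retract
  · rintro ⟨I, c, ⟨hc⟩, ⟨r⟩⟩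
    exact ⟨I, Fan.op c, ⟨Fan.IsLimit.op hc⟩, ⟨r.op⟩⟩

/-- Both inclusions are minimality: thickness is self-dual, so each side is a thick subcategory
containing the generators of the other. -/
lemma thick_op (P : ObjectProperty T) : thick P.op = (thick P).op := by
  apply le_antisymm
  · have : (thick P).op.IsStableUnderRetracts :=
      ⟨fun r h ↦ (thick P).prop_of_retract ⟨r.r.unop, r.i.unop, Quiver.Hom.op_inj r.retract⟩ h⟩
    exact thick_le (ObjectProperty.op_monotone (le_thick P))
  · have : (thick P.op).unop.IsStableUnderRetracts :=
      ⟨fun r h ↦ (thick P.op).prop_of_retract r.op h⟩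
    exact ObjectProperty.op_monotone (thick_le (Q := (thick P.op).unop)
      fun X hX ↦ le_thick P.op (Opposite.op X) hX)

variable {M t}

lemma IsCosiltingTStructure.op (h : IsCosiltingTStructure M t) :
    IsSiltingTStructure (op M) (opTStructure t) := by
  refine ⟨?_, ?_⟩
  · rw [rightPerp_op, ← h.2]
    rfl
  · rw [rightPerp_op, ← h.1]
    rfl

lemma add_op_le_rightPerp (h : TiltingHearts.prod M ≤ leftPerp M {0}ᶜ) :
    add (op M) ≤ rightPerp (op M) {0}ᶜ := by
  rw [add_op, rightPerp_op]
  exact ObjectProperty.op_monotone h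

end Opposite

/-! ### Projective generators and injective cogenerators -/

section Standard

open DerivedCategory Opposite CategoryTheory.Pretriangulated.Opposite

variable {A : Type u} [Category.{v} A] [Abelian A] [HasDerivedCategory.{w} A]

lemma subsingleton_ext_iff_homVanish [HasExt.{v'} A] (X Y : A) (n : ℕ) :
    Subsingleton (Abelian.Ext X Y n) ↔
      HomVanish ((singleFunctor A 0).obj X) (((singleFunctor A 0).obj Y)⟦(n : ℤ)⟧) := by
  rw [homVanish_iff_subsingleton]
  exact Abelian.Ext.homEquiv.subsingleton_congr

lemma heart_singleFunctor (X : A) : TStructure.t.heart ((singleFunctor A 0).obj X) :=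
  ⟨(inferInstance : ((singleFunctor A 0).obj X).IsLE 0).le,
    (inferInstance : ((singleFunctor A 0).obj X).IsGE 0).ge⟩

lemma exists_iso_singleFunctor_of_heart {X : DerivedCategory A} (hX : TStructure.t.heart X) :
    ∃ Y, Nonempty (X ≅ (singleFunctor A 0).obj Y) := by
  have h₁ : X.IsLE 0 := ⟨hX.1⟩
  have h₂ : X.IsGE 0 := ⟨hX.2⟩
  exact exists_iso_singleFunctor_obj_of_isGE_of_isLE X 0

/-- For the standard t-structure Ext is by construction Hom in the derived category, and its heart
consists of the stalk complexes in degree 0. -/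
lemma hasFiniteGlobalDimension_iff :
    HasFiniteGlobalDimension A ↔
      ∃ n : ℕ, 0 < n ∧ HeartVanish (TStructure.t : TStructure (DerivedCategory A)) n := by
  have := HasExt.standard A
  refine exists_congr fun n ↦ and_congr_right fun _ ↦ ⟨fun h X Y hX hY ↦ ?_, fun h X Y ↦ ?_⟩
  · obtain ⟨X', ⟨e⟩⟩ := exists_iso_singleFunctor_of_heart hX
    obtain ⟨Y', ⟨e'⟩⟩ := exists_iso_singleFunctor_of_heart hY
    rw [homVanish_iff_of_iso_left e,
      homVanish_iff_of_iso_right ((shiftFunctor _ (n : ℤ)).mapIso e')]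
    exact (subsingleton_ext_iff_homVanish _ _ _).1 (h X' Y')
  · exact (subsingleton_ext_iff_homVanish _ _ _).2
      (h _ _ (heart_singleFunctor X) (heart_singleFunctor Y))

lemma homVanish_of_projective (P : A) [Projective P] {X : DerivedCategory A}
    (hX : TStructure.t.le (-1) X) : HomVanish ((singleFunctor A 0).obj P) X := by
  obtain ⟨K, e, hK⟩ := hX
  rw [homVanish_iff_of_iso_right e]
  exact fun f ↦ from_singleFunctor_obj_eq_zero_of_projective f (-1) (by lia)

lemma homVanish_of_injective (E : A) [Injective E] {X : DerivedCategory A}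
    (hX : TStructure.t.ge 1 X) : HomVanish X ((singleFunctor A 0).obj E) := by
  obtain ⟨K, e, hK⟩ := hX
  rw [homVanish_iff_of_iso_left e]
  exact fun f ↦ to_singleFunctor_obj_eq_zero_of_injective f 1 (by lia)

lemma projective_of_homVanish (Q : A) (h : ∀ Y : A, HomVanish ((singleFunctor A 0).obj Q)
    (((singleFunctor A 0).obj Y)⟦(1 : ℤ)⟧)) : Projective Q := by
  have := HasExt.standard A
  exact projective_iff_subsingleton_ext_one.2
    fun Y ↦ (subsingleton_ext_iff_homVanish Q Y 1).2 (h Y)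

lemma injective_of_homVanish (Q : A) (h : ∀ Y : A, HomVanish ((singleFunctor A 0).obj Y)
    (((singleFunctor A 0).obj Q)⟦(1 : ℤ)⟧)) : Injective Q := by
  have := HasExt.standard A
  exact injective_iff_subsingleton_ext_one.2
    fun Y ↦ (subsingleton_ext_iff_homVanish Y Q 1).2 (h Y)

lemma isZero_of_forall_ge {X : DerivedCategory A} (h : ∀ n, TStructure.t.ge n X) : IsZero X := by
  have h₁ : X.IsGE 1 := ⟨h 1⟩
  have h₂ : X.IsLE 0 := (X.isLE_iff 0).2 fun i _ ↦ by
    have : X.IsGE (i + 1) := ⟨h _⟩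
    exact X.isZero_of_isGE (i + 1) i (lt_add_one i)
  exact TStructure.t.isZero X 0 1

lemma isZero_of_forall_le {X : DerivedCategory A} (h : ∀ n, TStructure.t.le n X) : IsZero X := by
  have h₁ : X.IsLE 0 := ⟨h 0⟩
  have h₂ : X.IsGE 1 := (X.isGE_iff 1).2 fun i _ ↦ by
    have : X.IsLE (i - 1) := ⟨h _⟩
    exact X.isZero_of_isLE (i - 1) i (sub_one_lt i)
  exact TStructure.t.isZero X 0 1

lemma isZero_of_isSeparator {P : A} (hP : IsSeparator P) {X : DerivedCategory A}
    (hX : TStructure.t.heart X) (h : HomVanish ((singleFunctor A 0).obj P) X) : IsZero X := by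
  obtain ⟨Y, ⟨e⟩⟩ := exists_iso_singleFunctor_of_heart hX
  rw [homVanish_iff_of_iso_right e] at h
  refine IsZero.of_iso ((singleFunctor A 0).map_isZero ?_) e
  rw [IsZero.iff_id_eq_zero]
  refine (isSeparator_def P).1 hP _ _ fun f ↦ (singleFunctor A 0).map_injective ?_
  exact (h _).trans (h _).symm

lemma isZero_of_isCoseparator {E : A} (hE : IsCoseparator E) {X : DerivedCategory A}
    (hX : TStructure.t.heart X) (h : HomVanish X ((singleFunctor A 0).obj E)) : IsZero X := by
  obtain ⟨Y, ⟨e⟩⟩ := exists_iso_singleFunctor_of_heart hX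
  rw [homVanish_iff_of_iso_left e] at h
  refine IsZero.of_iso ((singleFunctor A 0).map_isZero ?_) e
  rw [IsZero.iff_id_eq_zero]
  refine (isCoseparator_def E).1 hE _ _ fun f ↦ (singleFunctor A 0).map_injective ?_
  exact (h _).trans (h _).symm

lemma isProjGenerator_single {P : A} [Projective P] (hP : IsSeparator P) :
    IsProjGenerator ((singleFunctor A 0).obj P) TStructure.t where
  le := (heart_singleFunctor P).1
  homVanish _ := homVanish_of_projective P
  isZero _ := isZero_of_isSeparator hP
  isZero_of_ge _ := isZero_of_forall_ge
  isZero_of_le _ := isZero_of_forall_le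

lemma isProjGenerator_op_single {E : A} [Injective E] (hE : IsCoseparator E) :
    IsProjGenerator (op ((singleFunctor A 0).obj E)) (opTStructure TStructure.t) where
  le := (heart_singleFunctor E).2
  homVanish X hX := (homVanish_op_iff _ _).2 (homVanish_of_injective E hX)
  isZero X hX h := (isZero_of_isCoseparator hE ((opTStructure_heart_iff _ _).1 hX)
    ((homVanish_op_iff _ _).1 h)).op
  isZero_of_ge X h := (isZero_of_forall_le (X := X.unop) fun n ↦ by
    have h' : TStructure.t.le (- -n) X.unop := h (-n)
    rwa [neg_neg] at h').op
  isZero_of_le X h := (isZero_of_forall_ge (X := X.unop) fun n ↦ by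
    have h' : TStructure.t.ge (- -n) X.unop := h (-n)
    rwa [neg_neg] at h').op

/-- A projective generator of `A` is a tilting object of `D(A)`. -/
lemma add_single_le_rightPerp {P : A} [Projective P] (hP : IsSeparator P) :
    add ((singleFunctor A 0).obj P) ≤ rightPerp ((singleFunctor A 0).obj P) {0}ᶜ := by
  refine (isProjGenerator_single hP).add_le_rightPerp fun D hD h X hX ↦ ?_
  obtain ⟨Q, ⟨e⟩⟩ := exists_iso_singleFunctor_of_heart hD
  have := projective_of_homVanish Q fun Y ↦
    (homVanish_iff_of_iso_left e).1 (h _ (heart_singleFunctor Y))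
  exact (homVanish_iff_of_iso_left e).2 (homVanish_of_projective Q hX)

/-- An injective cogenerator of `A` is a cotilting object of `D(A)`. -/
lemma add_op_single_le_rightPerp {E : A} [Injective E] (hE : IsCoseparator E) :
    add (op ((singleFunctor A 0).obj E)) ≤
      rightPerp (op ((singleFunctor A 0).obj E)) {0}ᶜ := by
  refine (isProjGenerator_op_single hE).add_le_rightPerp fun D hD h X hX ↦ ?_
  obtain ⟨Q, ⟨e⟩⟩ := exists_iso_singleFunctor_of_heart ((opTStructure_heart_iff _ _).1 hD)
  have := injective_of_homVanish Q fun Y ↦ by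
    rw [← homVanish_iff_of_iso_right ((shiftFunctor _ (1 : ℤ)).mapIso e)]
    exact (homVanish_op_shift_iff D (op ((singleFunctor A 0).obj Y)) 1).1
      (h _ ((opTStructure_heart_iff _ _).2 (heart_singleFunctor Y)))
  exact (homVanish_op_iff _ _).2 ((homVanish_iff_of_iso_right e).2 (homVanish_of_injective Q hX))

/-- Finite global dimension passes from `A` to the hearts of t-structures in `D(A)` with the same
bounded objects. -/
theorem exists_heartVanish_of_hasFiniteGlobalDimension
    (t : TStructure (DerivedCategory A)) (ht : t.bounded = boundedDerived A)
    (hA : (HasProjectiveGenerator A ∧ HasCoproducts.{w} (DerivedCategory A)) ∨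
      (HasInjectiveCogenerator A ∧ HasProducts.{w} (DerivedCategory A)))
    (h : HasFiniteGlobalDimension A) : ∃ n : ℕ, 0 < n ∧ HeartVanish t n := by
  rw [hasFiniteGlobalDimension_iff] at h
  obtain ⟨⟨P, _, hP⟩, _⟩ | ⟨⟨E, _, hE⟩, _⟩ := hA
  -- The comparison is applied with the standard t-structure as the tilting one and `t` as the
  -- other.
  · exact exists_heartVanish_of_heartVanish (isProjGenerator_single hP).isSiltingTStructure
      (add_single_le_rightPerp hP) t ht.symm h
  -- Duality takes place in the opposite of D(A); the derived category of the opposite abelian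
  -- category is not involved.
  · simp only [← heartVanish_opTStructure_iff t,
      ← heartVanish_opTStructure_iff TStructure.t] at h ⊢
    exact exists_heartVanish_of_heartVanish (isProjGenerator_op_single hE).isSiltingTStructure
      (add_op_single_le_rightPerp hE) (opTStructure t)
      (by rw [opTStructure_bounded, opTStructure_bounded, ht]) h

end Standard

/-! ### The equivalence of the three conditions, in terms of morphisms in D(A). -/

section Comparison

open DerivedCategory Opposite CategoryTheory.Pretriangulated.Opposite

variable {A : Type u} [Category.{v} A] [Abelian A] [HasDerivedCategory.{w} A]
  (t : TStructure (DerivedCategory A)) (ht : t.bounded = boundedDerived A)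
  {M : DerivedCategory A}
include ht

/-- The comparison of hearts is used twice with the roles exchanged: the projective generator
carries finiteness to `t`, and the tilting object M carries it back. -/
theorem tfae_of_tilting [HasCoproducts.{w} (DerivedCategory A)] (hA : HasProjectiveGenerator A)
    (hM : add M ≤ rightPerp M {0}ᶜ) (h : IsSiltingTStructure M t) :
    List.TFAE [HasFiniteGlobalDimension A, ∃ n : ℕ, 0 < n ∧ HeartVanish t n,
      thick (add M) = boundedDerived A] := by
  tfae_have 1 → 2 :=
    exists_heartVanish_of_hasFiniteGlobalDimension t ht (Or.inl ⟨hA, inferInstance⟩)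
  tfae_have 2 → 1 := fun h' ↦ hasFiniteGlobalDimension_iff.2
    (exists_heartVanish_of_heartVanish h hM _ ht h')
  tfae_have 2 → 3 := fun h' ↦ le_antisymm
    (ht ▸ thick_le ((add_le_heart h hM).trans (heart_le_bounded t)))
    (ht ▸ bounded_le_thick h hM h')
  tfae_have 3 → 2 := fun h' ↦ exists_heartVanish_of_heart_le_thick h
    ((heart_le_bounded t).trans (ht.trans h'.symm).le)
  tfae_finish

theorem tfae_of_cotilting [HasProducts.{w} (DerivedCategory A)] (hA : HasInjectiveCogenerator A)
    (hM : TiltingHearts.prod M ≤ leftPerp M {0}ᶜ) (h : IsCosiltingTStructure M t) :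
    List.TFAE [HasFiniteGlobalDimension A, ∃ n : ℕ, 0 < n ∧ HeartVanish t n,
      thick (TiltingHearts.prod M) = boundedDerived A] := by
  have hM' := add_op_le_rightPerp hM
  have hb : (opTStructure t).bounded = (opTStructure TStructure.t).bounded := by
    rw [opTStructure_bounded, opTStructure_bounded, ht]
  have hthick : thick (TiltingHearts.prod M) = boundedDerived A ↔
      thick (add (op M)) = (opTStructure t).bounded := by
    rw [add_op, thick_op, opTStructure_bounded, ht, ObjectProperty.op_injective_iff]
  rw [hthick]
  simp only [← heartVanish_opTStructure_iff t]
  tfae_have 1 → 2 := fun h' ↦ by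
    simpa only [heartVanish_opTStructure_iff] using
      exists_heartVanish_of_hasFiniteGlobalDimension t ht (Or.inr ⟨hA, inferInstance⟩) h'
  tfae_have 2 → 1 := fun h' ↦ hasFiniteGlobalDimension_iff.2 (by
    simpa only [heartVanish_opTStructure_iff] using
      exists_heartVanish_of_heartVanish h.op hM' _ hb h')
  tfae_have 2 → 3 := fun h' ↦ le_antisymm
    (thick_le ((add_le_heart h.op hM').trans (heart_le_bounded _)))
    (bounded_le_thick h.op hM' h')
  tfae_have 3 → 2 := fun h' ↦ exists_heartVanish_of_heart_le_thick h.op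
    ((heart_le_bounded _).trans h'.ge)
  tfae_finish

end Comparison

/-! ### Dimension shifting for Ext -/

section DimensionShifting

open Abelian

variable {C : Type u} [Category.{v} C] [Abelian C] [HasExt.{w} C] {S : ShortComplex C}

lemma subsingleton_ext_iff_of_projective (hS : S.ShortExact) [Projective S.X₂] (Y : C) (n : ℕ) :
    Subsingleton (Ext.{w} S.X₃ Y (n + 2)) ↔ Subsingleton (Ext.{w} S.X₁ Y (n + 1)) := by
  constructor <;> intro h <;> refine subsingleton_of_forall_eq 0 fun x ↦ ?_
  · obtain ⟨y, rfl⟩ := Ext.contravariant_sequence_exact₁ hS Y x (n₁ := n + 2) (by lia)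
      (Subsingleton.elim _ _)
    rw [Ext.eq_zero_of_projective y, Ext.comp_zero]
  · obtain ⟨y, rfl⟩ := Ext.contravariant_sequence_exact₃ hS Y x
      (Ext.eq_zero_of_projective _) (n₀ := n + 1) (by lia)
    rw [Subsingleton.elim y 0, Ext.comp_zero]

/-- In degree 1 vanishing is expressed through extension of morphisms. That condition involves only
Hom, so it reads the same in the heart and in the triangulated category (compare
`homVanish_shift_one_iff_of_projective`). -/
lemma subsingleton_ext_one_iff_of_projective (hS : S.ShortExact) [Projective S.X₂] (Y : C) :
    Subsingleton (Ext.{w} S.X₃ Y 1) ↔ ∀ g : S.X₁ ⟶ Y, ∃ h, S.f ≫ h = g := by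
  constructor
  · intro h g
    obtain ⟨y, hy⟩ := Ext.contravariant_sequence_exact₁ hS Y (Ext.mk₀ g) (n₁ := 1) rfl
      (Subsingleton.elim _ _)
    obtain ⟨y, rfl⟩ := (Ext.mk₀_bijective _ _).2 y
    exact ⟨y, (Ext.mk₀_bijective _ _).1 (by rw [← hy, Ext.mk₀_comp_mk₀])⟩
  · refine fun h ↦ subsingleton_of_forall_eq 0 fun x ↦ ?_
    obtain ⟨y, rfl⟩ := Ext.contravariant_sequence_exact₃ hS Y x
      (Ext.eq_zero_of_projective _) (n₀ := 0) rfl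
    obtain ⟨y, rfl⟩ := (Ext.mk₀_bijective _ _).2 y
    obtain ⟨g, rfl⟩ := h y
    rw [← Ext.mk₀_comp_mk₀, hS.extClass_comp_assoc]

lemma subsingleton_ext_iff_of_injective (hS : S.ShortExact) [Injective S.X₂] (X : C) (n : ℕ) :
    Subsingleton (Ext.{w} X S.X₁ (n + 2)) ↔ Subsingleton (Ext.{w} X S.X₃ (n + 1)) := by
  constructor <;> intro h <;> refine subsingleton_of_forall_eq 0 fun x ↦ ?_
  · obtain ⟨y, rfl⟩ := Ext.covariant_sequence_exact₃ X hS x (n₁ := n + 2) (by lia)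
      (Subsingleton.elim _ _)
    rw [Ext.eq_zero_of_injective y, Ext.zero_comp]
  · obtain ⟨y, rfl⟩ := Ext.covariant_sequence_exact₁ X hS x
      (Ext.eq_zero_of_injective _) (n₀ := n + 1) (by lia)
    rw [Subsingleton.elim y 0, Ext.zero_comp]

lemma subsingleton_ext_one_iff_of_injective (hS : S.ShortExact) [Injective S.X₂] (X : C) :
    Subsingleton (Ext.{w} X S.X₁ 1) ↔ ∀ g : X ⟶ S.X₃, ∃ h, h ≫ S.g = g := by
  constructor
  · intro h g
    obtain ⟨y, hy⟩ := Ext.covariant_sequence_exact₃ X hS (Ext.mk₀ g) (n₁ := 1) rfl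
      (Subsingleton.elim _ _)
    obtain ⟨y, rfl⟩ := (Ext.mk₀_bijective _ _).2 y
    exact ⟨y, (Ext.mk₀_bijective _ _).1 (by rw [← hy, Ext.mk₀_comp_mk₀])⟩
  · refine fun h ↦ subsingleton_of_forall_eq 0 fun x ↦ ?_
    obtain ⟨y, rfl⟩ := Ext.covariant_sequence_exact₁ X hS x
      (Ext.eq_zero_of_injective _) (n₀ := 0) rfl
    obtain ⟨y, rfl⟩ := (Ext.mk₀_bijective _ _).2 y
    obtain ⟨g, rfl⟩ := h y
    rw [← Ext.mk₀_comp_mk₀, Ext.comp_assoc_of_second_deg_zero, hS.comp_extClass, Ext.comp_zero]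

end DimensionShifting

/-! ### Extensions in the heart -/

section HeartExt

variable {T : Type u} [Category.{v} T] [Preadditive T] [HasZeroObject T] [HasShift T ℤ]
  [∀ n : ℤ, (shiftFunctor T n).Additive] [Pretriangulated T] [IsTriangulated T]
  {t : TStructure T}

/-- The short complex in the heart given by a distinguished triangle. -/
def heartShortComplex {D : Triangle T} (hD : D ∈ distTriang T)
    (h₁ : t.heart D.obj₁) (h₂ : t.heart D.obj₂) (h₃ : t.heart D.obj₃) :
    ShortComplex (Heart t) where
  X₁ := ⟨D.obj₁, h₁⟩
  X₂ := ⟨D.obj₂, h₂⟩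
  X₃ := ⟨D.obj₃, h₃⟩
  f := ObjectProperty.homMk D.mor₁
  g := ObjectProperty.homMk D.mor₂
  zero := ObjectProperty.hom_ext _ (comp_distTriang_mor_zero₁₂ D hD)

lemma heartShortComplex_shortExact {D : Triangle T} (hD : D ∈ distTriang T)
    (h₁ : t.heart D.obj₁) (h₂ : t.heart D.obj₂) (h₃ : t.heart D.obj₃) :
    (heartShortComplex hD h₁ h₂ h₃).ShortExact := by
  let S := heartShortComplex hD h₁ h₂ h₃
  have hk := AbelianSubcategory.isLimitKernelForkOfDistTriang (heart_hom_shift_neg t)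
    S.f S.g D.mor₃ hD
  have hc := AbelianSubcategory.isColimitCokernelCoforkOfDistTriang (heart_hom_shift_neg t)
    S.f S.g D.mor₃ hD
  exact { exact := S.exact_of_f_is_kernel hk
          mono_f := mono_of_isLimit_fork hk
          epi_g := epi_of_isColimit_cofork hc }

/-- An epimorphism of the heart completes to a triangle with kernel K in the heart, so the
obstruction to lifting lies in Hom(P, K[1]). -/
lemma projective_of_heart {P : T} (hP : t.heart P)
    (h : ∀ Y, t.heart Y → HomVanish P (Y⟦(1 : ℤ)⟧)) : Projective (⟨P, hP⟩ : Heart t) where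
  factors f π _ := by
    obtain ⟨K, i, δ, hD⟩ := AbelianSubcategory.exists_distinguished_triangle_of_epi
      (heart_hom_shift_neg t) (heart_admissible t) π
    obtain ⟨g, hg⟩ := Triangle.coyoneda_exact₃ _ hD f.hom (h _ K.2 _)
    exact ⟨ObjectProperty.homMk g, ObjectProperty.hom_ext _ hg.symm⟩

/-- The triangle is that of the epimorphism onto the cokernel of `j`; its first term is a kernel of
this epimorphism, as is X, and the two are identified through `e`. -/
lemma exists_distTriang_of_mono {X Y : Heart t} (j : X ⟶ Y) [Mono j] :
    ∃ (Z : Heart t) (p : Y ⟶ Z) (δ : Z.obj ⟶ X.obj⟦(1 : ℤ)⟧),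
      Triangle.mk j.hom p.hom δ ∈ distTriang T := by
  obtain ⟨K, i, δ, hD⟩ := AbelianSubcategory.exists_distinguished_triangle_of_epi
    (heart_hom_shift_neg t) (heart_admissible t) (cokernel.π j)
  have hk := AbelianSubcategory.isLimitKernelForkOfDistTriang (heart_hom_shift_neg t) _ _ _ hD
  have hj := Abelian.monoIsKernelOfCokernel _ (cokernelIsCokernel j)
  let e : X ≅ K := hj.conePointUniqueUpToIso hk
  have he : e.hom ≫ i = j := hj.conePointUniqueUpToIso_hom_comp hk WalkingParallelPair.zero
  refine ⟨_, cokernel.π j, δ ≫ (t.heart.ι.map e.inv)⟦(1 : ℤ)⟧', ?_⟩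
  refine isomorphic_distinguished _ hD _ ?_
  refine Triangle.isoMk _ _ (t.heart.ι.mapIso e) (Iso.refl _) (Iso.refl _) ?_ ?_ ?_
  · exact (Category.comp_id _).trans (congrArg (fun f ↦ f.hom) he).symm
  · exact (Category.comp_id _).trans (Category.id_comp _).symm
  · refine Eq.trans ?_ (Category.id_comp _).symm
    exact (Category.assoc _ _ _).trans ((congrArg (δ ≫ ·)
      ((t.heart.ι ⋙ shiftFunctor T (1 : ℤ)).mapIso e).inv_hom_id).trans (Category.comp_id _))

lemma injective_of_heart {I : T} (hI : t.heart I)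
    (h : ∀ X, t.heart X → HomVanish X (I⟦(1 : ℤ)⟧)) : Injective (⟨I, hI⟩ : Heart t) where
  factors f j _ := by
    obtain ⟨Z, p, δ, hD⟩ := exists_distTriang_of_mono j
    obtain ⟨g, hg⟩ := Triangle.yoneda_exact₂ _ (inv_rot_of_distTriang _ hD) f.hom
      ((homVanish_shift_left_iff _ _ (-1) 1 (by lia)).2 (h _ Z.2) _)
    exact ⟨ObjectProperty.homMk g, ObjectProperty.hom_ext _ hg.symm⟩

lemma homVanish_shift_one_iff_of_projective {D : Triangle T} (hD : D ∈ distTriang T) {Y : T}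
    (h : HomVanish D.obj₂ (Y⟦(1 : ℤ)⟧)) :
    HomVanish D.obj₃ (Y⟦(1 : ℤ)⟧) ↔ ∀ g : D.obj₁ ⟶ Y, ∃ h, D.mor₁ ≫ h = g := by
  constructor
  · intro h' g
    obtain ⟨k, hk⟩ := Triangle.yoneda_exact₂ _ (inv_rot_of_distTriang _ hD) g
      ((homVanish_shift_left_iff _ _ (-1) 1 (by lia)).2 h' _)
    exact ⟨k, hk.symm⟩
  · intro h' f
    obtain ⟨g, hg⟩ := Triangle.yoneda_exact₃ _ hD f (h _)
    obtain ⟨g, rfl⟩ := (shiftFunctor T (1 : ℤ)).map_surjective g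
    obtain ⟨k, rfl⟩ := h' g
    rw [hg, Functor.map_comp, ← Category.assoc, comp_distTriang_mor_zero₃₁ D hD, zero_comp]

lemma homVanish_shift_one_iff_of_injective {D : Triangle T} (hD : D ∈ distTriang T) {X : T}
    (h : HomVanish X (D.obj₂⟦(1 : ℤ)⟧)) :
    HomVanish X (D.obj₁⟦(1 : ℤ)⟧) ↔ ∀ g : X ⟶ D.obj₃, ∃ h, h ≫ D.mor₂ = g := by
  constructor
  · intro h' g
    obtain ⟨k, hk⟩ := Triangle.coyoneda_exact₃ _ hD g (h' _)
    exact ⟨k, hk.symm⟩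
  · intro h' f
    obtain ⟨g, hg⟩ := Triangle.coyoneda_exact₁ _ hD f (h _)
    obtain ⟨k, rfl⟩ := h' g
    rw [hg, Category.assoc, comp_distTriang_mor_zero₂₃ D hD, comp_zero]

/-- `Ext` in the heart and `Hom` in the triangulated category vanish simultaneously if the heart
has enough objects that are projective in the triangulated sense. -/
theorem subsingleton_ext_heart_iff_of_projective [HasExt.{w} (Heart t)] (P : ObjectProperty T)
    (hP : P ≤ t.heart)
    (hP' : ∀ X Y, P X → t.heart Y → ∀ n : ℤ, 0 < n → HomVanish X (Y⟦n⟧))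
    (h : ∀ X, t.heart X → ∃ D ∈ distTriang T, t.heart D.obj₁ ∧ P D.obj₂ ∧ D.obj₃ = X)
    (X Y : Heart t) (n : ℕ) :
    Subsingleton (Abelian.Ext.{w} X Y (n + 1)) ↔ HomVanish X.obj (Y.obj⟦(n + 1 : ℤ)⟧) := by
  obtain ⟨X, hX⟩ := X
  induction n generalizing X with
  | zero =>
    obtain ⟨D, hD, h₁, h₂, rfl⟩ := h X hX
    have : Projective (heartShortComplex hD h₁ (hP _ h₂) hX).X₂ :=
      projective_of_heart (hP _ h₂) fun Y hY ↦ hP' _ Y h₂ hY 1 zero_lt_one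
    have := subsingleton_ext_one_iff_of_projective.{w}
      (heartShortComplex_shortExact hD h₁ (hP _ h₂) hX) Y
    -- Both sides now say that morphisms from the syzygy to Y extend to the cover, and the heart is
    -- a full subcategory.
    refine this.trans ?_
    rw [Nat.cast_zero, zero_add,
      homVanish_shift_one_iff_of_projective hD (hP' _ _ h₂ Y.2 1 zero_lt_one)]
    exact ⟨fun H g ↦ (H (ObjectProperty.homMk g)).imp' (fun f ↦ f.hom) fun f hf ↦
        congrArg (fun f ↦ f.hom) hf,
      fun H g ↦ (H g.hom).imp' ObjectProperty.homMk fun f hf ↦ ObjectProperty.hom_ext _ hf⟩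
  | succ n ih =>
    obtain ⟨D, hD, h₁, h₂, rfl⟩ := h X hX
    have : Projective (heartShortComplex hD h₁ (hP _ h₂) hX).X₂ :=
      projective_of_heart (hP _ h₂) fun Y hY ↦ hP' _ Y h₂ hY 1 zero_lt_one
    -- Ext and Hom undergo the same dimension shift to the syzygy.
    refine (subsingleton_ext_iff_of_projective.{w}
      (heartShortComplex_shortExact hD h₁ (hP _ h₂) hX) Y n).trans ((ih D.obj₁ h₁).trans ?_)
    push_cast
    have hP₂ := fun m ↦ hP' _ _ h₂ Y.2 m
    exact ⟨fun H ↦ HomVanish.from_obj₃ hD rfl H (hP₂ _ (by lia)),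
      fun H ↦ HomVanish.from_obj₁ hD rfl (hP₂ _ (by lia)) H⟩

/-- `Ext` in the heart and `Hom` in the triangulated category vanish simultaneously if the heart
has enough objects that are injective in the triangulated sense. -/
theorem subsingleton_ext_heart_iff_of_injective [HasExt.{w} (Heart t)] (P : ObjectProperty T)
    (hP : P ≤ t.heart)
    (hP' : ∀ X Y, t.heart X → P Y → ∀ n : ℤ, 0 < n → HomVanish X (Y⟦n⟧))
    (h : ∀ X, t.heart X → ∃ D ∈ distTriang T, D.obj₁ = X ∧ P D.obj₂ ∧ t.heart D.obj₃)
    (X Y : Heart t) (n : ℕ) :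
    Subsingleton (Abelian.Ext.{w} X Y (n + 1)) ↔ HomVanish X.obj (Y.obj⟦(n + 1 : ℤ)⟧) := by
  obtain ⟨Y, hY⟩ := Y
  induction n generalizing Y with
  | zero =>
    obtain ⟨D, hD, rfl, h₂, h₃⟩ := h Y hY
    have : Injective (heartShortComplex hD hY (hP _ h₂) h₃).X₂ :=
      injective_of_heart (hP _ h₂) fun X hX ↦ hP' X _ hX h₂ 1 zero_lt_one
    have := subsingleton_ext_one_iff_of_injective.{w}
      (heartShortComplex_shortExact hD hY (hP _ h₂) h₃) X
    refine this.trans ?_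
    rw [Nat.cast_zero, zero_add,
      homVanish_shift_one_iff_of_injective hD (hP' _ _ X.2 h₂ 1 zero_lt_one)]
    exact ⟨fun H g ↦ (H (ObjectProperty.homMk g)).imp' (fun f ↦ f.hom) fun f hf ↦
        congrArg (fun f ↦ f.hom) hf,
      fun H g ↦ (H g.hom).imp' ObjectProperty.homMk fun f hf ↦ ObjectProperty.hom_ext _ hf⟩
  | succ n ih =>
    obtain ⟨D, hD, rfl, h₂, h₃⟩ := h Y hY
    have : Injective (heartShortComplex hD hY (hP _ h₂) h₃).X₂ :=
      injective_of_heart (hP _ h₂) fun X hX ↦ hP' X _ hX h₂ 1 zero_lt_one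
    refine (subsingleton_ext_iff_of_injective.{w}
      (heartShortComplex_shortExact hD hY (hP _ h₂) h₃) X n).trans ((ih D.obj₃ h₃).trans ?_)
    push_cast
    have hP₂ := fun m ↦ hP' _ _ X.2 h₂ m
    exact ⟨fun H ↦ HomVanish.to_shift_obj₁ hD rfl H (hP₂ _ (by lia)),
      fun H ↦ HomVanish.to_shift_obj₃ hD rfl (hP₂ _ (by lia)) H⟩

lemma hasFiniteGlobalDimension_heart_iff
    (h : ∀ [HasExt.{max u v} (Heart t)] (X Y : Heart t) (n : ℕ),
      Subsingleton (Abelian.Ext.{max u v} X Y (n + 1)) ↔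
        HomVanish X.obj (Y.obj⟦(n + 1 : ℤ)⟧)) :
    HasFiniteGlobalDimension (Heart t) ↔ ∃ n : ℕ, 0 < n ∧ HeartVanish t n := by
  have := HasExt.standard (Heart t)
  refine exists_congr fun n ↦ and_congr_right fun hn ↦ ?_
  obtain ⟨n, rfl⟩ : ∃ m, n = m + 1 := ⟨n - 1, by lia⟩
  push_cast
  exact ⟨fun H X Y hX hY ↦ (h ⟨X, hX⟩ ⟨Y, hY⟩ n).1 (H _ _),
    fun H X Y ↦ (h X Y n).2 (H _ _ X.2 Y.2)⟩

theorem hasFiniteGlobalDimension_heart_iff_of_silting [HasCoproducts.{v} T] {M : T}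
    (h : IsSiltingTStructure M t) (hM : add M ≤ rightPerp M {0}ᶜ) :
    HasFiniteGlobalDimension (Heart t) ↔ ∃ n : ℕ, 0 < n ∧ HeartVanish t n :=
  hasFiniteGlobalDimension_heart_iff fun {_} ↦ subsingleton_ext_heart_iff_of_projective (add M)
    (add_le_heart h hM) (fun _ _ hX hY _ ↦ homVanish_of_add_of_le h hX hY.1)
    (fun _ ↦ exists_triangle_of_heart h hM)

open Opposite CategoryTheory.Pretriangulated.Opposite in
-- The opposite category only supplies the vanishing and the triangles. Ext is compared in the heart
-- of `t` itself, with Prod(M) as injectives, which avoids identifying the heart of the opposite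
-- t-structure with an opposite category.
theorem hasFiniteGlobalDimension_heart_iff_of_cosilting [HasProducts.{v} T] {M : T}
    (h : IsCosiltingTStructure M t) (hM : TiltingHearts.prod M ≤ leftPerp M {0}ᶜ) :
    HasFiniteGlobalDimension (Heart t) ↔ ∃ n : ℕ, 0 < n ∧ HeartVanish t n := by
  have hM' := add_op_le_rightPerp hM
  refine hasFiniteGlobalDimension_heart_iff fun {_} ↦
    subsingleton_ext_heart_iff_of_injective (TiltingHearts.prod M) ?_ ?_ ?_
  · intro X hX
    rw [← opTStructure_heart_iff t (op X)]
    exact add_le_heart h.op hM' _ (by rwa [add_op])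
  · intro X Y hX hY n hn
    exact (homVanish_op_shift_iff (op Y) (op X) n).1 (homVanish_of_add_of_le h.op
      (by rwa [add_op]) ((opTStructure_heart_iff t (op X)).2 hX).1 hn)
  · intro X hX
    obtain ⟨D, hD, h₁, h₂, h₃⟩ := exists_triangle_of_heart h.op hM'
      ((opTStructure_heart_iff t (op X)).2 hX)
    refine ⟨_, unop_distinguished D hD, congrArg unop h₃, ?_, (opTStructure_heart_iff t _).1 h₁⟩
    rwa [add_op] at h₂

end HeartExt
/-! ### Realisation functors on stalk complexes -/

section Realisation

variable {T : Type u} [Category.{v} T] [Preadditive T] [HasZeroObject T] [HasShift T ℤ]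
  [∀ n : ℤ, (shiftFunctor T n).Additive] [Pretriangulated T] [IsTriangulated T]
  {X : Type u'} [Category.{v'} X] [Preadditive X] [HasZeroObject X] [HasShift X ℤ]
  [∀ n : ℤ, (shiftFunctor X n).Additive] [Pretriangulated X] [IsTriangulated X]

namespace FCategory

variable (F : FCategory X)

/-- The cone of the counit lies in X(≤ n - 1), which the truncation onto X(≥ n + 1) annihilates. -/
lemma isIso_σGE_map_σGEι (n : ℤ) (A : X) :
    IsIso ((F.σGE (n + 1)).map ((F.σGEι n).app A)) :=
  (F.stable (n + 1)).isIso₁_truncLT_map_of_isGE _ ((F.stable n).triangleLTGE_distinguished 0 A) 0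
    ⟨F.le_monotone (by lia) _
      (inferInstance : (F.stable n).IsGE (((F.stable n).truncGE 0).obj A) 0).ge⟩

lemma exists_distTriang_slice (n : ℤ) (A : X) :
    ∃ D ∈ distTriang X, Nonempty (D.obj₁ ≅ (F.σGE (n + 1)).obj A) ∧
      D.obj₂ = (F.σGE n).obj A ∧ D.obj₃ = (F.slice n).obj A := by
  have : IsIso ((F.σGE (n + 1)).map ((F.σGEι n).app A)) := F.isIso_σGE_map_σGEι n A
  exact ⟨_, (F.stable (n + 1)).triangleLTGE_distinguished 0 ((F.σGE n).obj A),
    ⟨@asIso _ _ _ _ ((F.σGE (n + 1)).map ((F.σGEι n).app A)) this⟩, rfl, rfl⟩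

lemma isIso_σGEι_of_ge {n : ℤ} {A : X} (h : F.ge n A) : IsIso ((F.σGEι n).app A) :=
  ((F.stable n).isLE_iff_isIso_truncLTι_app (-1) 0 (by lia) A).1 ⟨h⟩

lemma isZero_σGE_of_le {n m : ℤ} (h : m < n) {A : X} (hA : F.le m A) :
    IsZero ((F.σGE n).obj A) := by
  have : (F.stable n).IsGE A 0 := ⟨F.le_monotone (by lia) _ hA⟩
  exact (F.stable n).isZero_truncLT_obj_of_isGE 0 A

end FCategory

namespace ForgetfulFunctor

variable {E : FEnhancement T X} (W : ForgetfulFunctor E)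

lemma exists_distTriang_gr (n : ℤ) (A : X) :
    ∃ D ∈ distTriang T, Nonempty (D.obj₁ ≅ W.ω.obj ((E.σGE (n + 1)).obj A)) ∧
      D.obj₂ = W.ω.obj ((E.σGE n).obj A) ∧ D.obj₃ = (W.gr n).obj A := by
  obtain ⟨D, hD, ⟨e⟩, h₂, h₃⟩ := E.exists_distTriang_slice n A
  exact ⟨_, W.ω.map_distinguished D hD, ⟨W.ω.mapIso e⟩, congrArg W.ω.obj h₂,
    congrArg W.ω.obj h₃⟩

lemma nonempty_iso_of_isZero_gr (n : ℤ) (A : X) (h : IsZero ((W.gr n).obj A)) :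
    Nonempty (W.ω.obj ((E.σGE (n + 1)).obj A) ≅ W.ω.obj ((E.σGE n).obj A)) := by
  obtain ⟨D, hD, ⟨e⟩, h₂, h₃⟩ := W.exists_distTriang_gr n A
  have := (Triangle.isZero₃_iff_isIso₁ D hD).1 (h₃ ▸ h)
  exact ⟨e.symm ≪≫ asIso D.mor₁ ≪≫ eqToIso h₂⟩

lemma nonempty_iso_gr (n : ℤ) (A : X) (h : IsZero (W.ω.obj ((E.σGE (n + 1)).obj A))) :
    Nonempty (W.ω.obj ((E.σGE n).obj A) ≅ (W.gr n).obj A) := by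
  obtain ⟨D, hD, ⟨e⟩, h₂, h₃⟩ := W.exists_distTriang_gr n A
  have := (Triangle.isZero₁_iff_isIso₂ D hD).1 (h.of_iso e)
  exact ⟨eqToIso h₂.symm ≪≫ asIso D.mor₂ ≪≫ eqToIso h₃⟩

/-- If only one graded piece of `A` is nonzero, `ω` sends `A` to this graded piece. -/
lemma nonempty_iso_gr_of_isZero (m : ℤ) (A : X)
    (h : ∀ n, n ≠ m → IsZero ((W.gr n).obj A)) : Nonempty (W.ω.obj A ≅ (W.gr m).obj A) := by
  obtain ⟨⟨a, ha⟩, ⟨b, hb⟩⟩ := E.exhaustive A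
  -- Above m nothing survives: descend from filtration degrees beyond b, where the truncation is
  -- zero; `k` controls the distance left to climb.
  have h₁ : ∀ k : ℕ, ∀ n, m < n → b < n + k → IsZero (W.ω.obj ((E.σGE n).obj A)) := by
    intro k
    induction k with
    | zero => exact fun n _ hn ↦ W.ω.map_isZero (E.isZero_σGE_of_le (by lia) hb)
    | succ k ih =>
      intro n hn hn'
      obtain ⟨e⟩ := W.nonempty_iso_of_isZero_gr n A (h n (by lia))
      exact (ih (n + 1) (by lia) (by lia)).of_iso e.symm
  -- Below m the vanishing graded pieces leave `ω` of the truncation unchanged, until the truncation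
  -- is all of A.
  have h₂ : ∀ k : ℕ, Nonempty (W.ω.obj ((E.σGE (m - k)).obj A) ≅ (W.gr m).obj A) := by
    intro k
    induction k with
    | zero =>
      rw [Nat.cast_zero, sub_zero]
      exact W.nonempty_iso_gr m A (h₁ (b - m).toNat _ (by lia) (by lia))
    | succ k ih =>
      obtain ⟨e⟩ := W.nonempty_iso_of_isZero_gr (m - (k + 1 : ℕ)) A (h _ (by lia))
      rw [show m - (k + 1 : ℕ) + 1 = m - k by lia] at e
      exact ih.map fun e' ↦ e.symm ≪≫ e'
  obtain ⟨e⟩ := h₂ (m - a).toNat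
  have := E.isIso_σGEι_of_ge (n := m - (m - a).toNat) (E.ge_antitone (by lia) _ ha)
  exact ⟨(W.ω.mapIso (asIso ((E.σGEι _).app A))).symm ≪≫ e⟩

/-- The complex with the object `Y` of the heart in degree `m`. -/
def stalk {t : TStructure T} (Y : Heart t) (m : ℤ) : BoundedComplex (Heart t) :=
  ⟨(HomologicalComplex.single (Heart t) (.up ℤ) m).obj Y, m, m, inferInstance, inferInstance⟩

variable {t : TStructure T} [HasDerivedCategory.{w} (Heart t)]
  {real : BoundedDerivedCategory (Heart t) ⥤ T}

/-- The object of the filtered heart corresponding to a stalk complex has a single nonzero graded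
piece, so `ω` returns that piece. All degrees m are treated because a realisation functor is not
assumed to commute with shifts. -/
lemma IsRealisation.nonempty_iso_stalk (h : W.IsRealisation t real) (Y : Heart t) (m : ℤ) :
    Nonempty ((real.obj ((boundedQ (Heart t)).obj (stalk Y m)))⟦m⟧ ≅ Y.obj) := by
  obtain ⟨G, -, ⟨e⟩, ⟨e'⟩⟩ := h
  let A := G.obj (stalk Y m)
  have hA : ∀ n, Nonempty (t.heart.ι.obj (W.heartObj t A n) ≅
      t.heart.ι.obj (((HomologicalComplex.single (Heart t) (.up ℤ) m).obj Y).X n)) := fun n ↦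
    ⟨((boundedComplex (Heart t)).ι ⋙ HomologicalComplex.eval _ _ n ⋙ t.heart.ι).mapIso
      (e.app (stalk Y m))⟩
  have hz : ∀ n, n ≠ m → IsZero ((W.gr n).obj A.obj) := fun n hn ↦ by
    obtain ⟨i⟩ := hA n
    have : IsZero (((W.gr n).obj A.obj)⟦n⟧) := IsZero.of_iso
      (t.heart.ι.map_isZero (HomologicalComplex.isZero_single_obj_X _ _ _ _ hn)) i
    exact ((shiftFunctor T (-n)).map_isZero this).of_iso
      ((shiftFunctorCompIsoId T n (-n) (by lia)).symm.app _)
  obtain ⟨i⟩ := W.nonempty_iso_gr_of_isZero m A.obj hz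
  obtain ⟨j⟩ := hA m
  exact ⟨(shiftFunctor T m).mapIso (e'.app (stalk Y m) ≪≫ i) ≪≫ j ≪≫
    t.heart.ι.mapIso (HomologicalComplex.singleObjXSelf _ _ _)⟩

lemma IsRealisation.homVanish_single (h : W.IsRealisation t real)
    [real.Faithful] (X Y : Heart t) (n : ℤ) (hXY : HomVanish X.obj (Y.obj⟦n⟧)) :
    -- The shift Y[n] is represented by the stalk complex of Y in degree -n, so that only the values
    -- of `real` on stalks and its faithfulness are needed.
    HomVanish ((DerivedCategory.singleFunctor (Heart t) 0).obj X)
      (((DerivedCategory.singleFunctor (Heart t) 0).obj Y)⟦n⟧) := by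
  obtain ⟨e⟩ := IsRealisation.nonempty_iso_stalk W h X 0
  obtain ⟨e'⟩ := IsRealisation.nonempty_iso_stalk W h Y (-n)
  rw [← homVanish_iff_of_iso_left e,
    homVanish_iff_of_iso_right ((shiftFunctor T n).mapIso e'.symm),
    homVanish_shift_add_iff _ _ (-n) n 0 (by lia), homVanish_shift_shift_iff] at hXY
  refine (homVanish_iff_of_iso_right (((DerivedCategory.singleFunctors (Heart t)).shiftIso
    n (-n) 0 (by lia)).app Y)).2 fun f ↦ ?_
  let f' : (boundedQ (Heart t)).obj (stalk X 0) ⟶ (boundedQ (Heart t)).obj (stalk Y (-n)) :=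
    ObjectProperty.homMk f
  have hf : f' = ObjectProperty.homMk 0 :=
    real.map_injective ((hXY _).trans (hXY _).symm)
  exact congrArg (fun f ↦ f.hom) hf

theorem IsRealisation.hasFiniteGlobalDimension (h : W.IsRealisation t real) [real.Faithful]
    (H : ∃ n : ℕ, 0 < n ∧ HeartVanish t n) : HasFiniteGlobalDimension (Heart t) := by
  have := HasExt.standard (Heart t)
  obtain ⟨n, hn, H⟩ := H
  exact ⟨n, hn, fun X Y ↦ (subsingleton_ext_iff_homVanish X Y n).2
    (IsRealisation.homVanish_single W h X Y n (H _ _ X.2 Y.2))⟩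

end ForgetfulFunctor

end Realisation
end TiltingHearts

end

/-! ### Assembly: from vanishing of morphisms to global dimension of the heart. -/

theorem proposition5p8 {A : Type u} [Category.{v} A] [Abelian A] [HasDerivedCategory.{v} A]
    (t : TStructure (DerivedCategory A))
    (ht : t.bounded = TiltingHearts.boundedDerived A) :
    -- finite global dimension passes to the heart
    (((TiltingHearts.HasProjectiveGenerator A ∧ HasCoproducts.{v} (DerivedCategory A)) ∨
        (TiltingHearts.HasInjectiveCogenerator A ∧ HasProducts.{v} (DerivedCategory A))) →
      ∀ (X : Type u') [Category.{v'} X] [Preadditive X] [HasZeroObject X] [HasShift X ℤ]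
        [∀ n : ℤ, (shiftFunctor X n).Additive] [Pretriangulated X] [IsTriangulated X]
        (E : TiltingHearts.FEnhancement (DerivedCategory A) X)
        (W : TiltingHearts.ForgetfulFunctor E)
        [HasDerivedCategory.{w} (TiltingHearts.Heart t)]
        (real : TiltingHearts.BoundedDerivedCategory (TiltingHearts.Heart t) ⥤ DerivedCategory A),
        W.IsRealisation t real → real.Full → real.Faithful →
        TiltingHearts.HasFiniteGlobalDimension A →
        TiltingHearts.HasFiniteGlobalDimension (TiltingHearts.Heart t)) ∧
    -- tilting objects
    (TiltingHearts.HasProjectiveGenerator A → HasCoproducts.{v} (DerivedCategory A) →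
      ∀ M : DerivedCategory A, TiltingHearts.IsTilting M →
        TiltingHearts.IsSiltingTStructure M t →
        List.TFAE [TiltingHearts.HasFiniteGlobalDimension A,
          TiltingHearts.HasFiniteGlobalDimension (TiltingHearts.Heart t),
          TiltingHearts.thick (TiltingHearts.add M) = TiltingHearts.boundedDerived A]) ∧
    -- cotilting objects
    (TiltingHearts.HasInjectiveCogenerator A → HasProducts.{v} (DerivedCategory A) →
      ∀ M : DerivedCategory A, TiltingHearts.IsCotilting M →
        TiltingHearts.IsCosiltingTStructure M t →
        List.TFAE [TiltingHearts.HasFiniteGlobalDimension A,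
          TiltingHearts.HasFiniteGlobalDimension (TiltingHearts.Heart t),
          TiltingHearts.thick (TiltingHearts.prod M) = TiltingHearts.boundedDerived A]) := by
  open TiltingHearts in
  refine ⟨fun hA X _ _ _ _ _ _ _ E W _ real h _ _ hfin ↦
    ForgetfulFunctor.IsRealisation.hasFiniteGlobalDimension W h
      (exists_heartVanish_of_hasFiniteGlobalDimension t ht hA hfin),
    fun hA _ M hM h ↦ ?_, fun hA _ M hM h ↦ ?_⟩
  · rw [hasFiniteGlobalDimension_heart_iff_of_silting h hM.2]
    exact tfae_of_tilting t ht hA hM.2 h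
  · rw [hasFiniteGlobalDimension_heart_iff_of_cosilting h hM.2]
    exact tfae_of_cotilting t ht hA hM.2 h
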